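/- Let $S\subset S^{n-1}\subset\mathbb R^n$ be a finite set of unit vectors with $S=-S$ (a configuration), and put $P_{\mathbf x}(\mathbf y)=\langle \mathbf y,\mathbf x\rangle\mathbf x$. $S$ is perfect if the maps $P_{\mathbf x}$, $\mathbf x\in S$, span the space of symmetric linear maps $\mathbb R^n\to\mathbb R^n$. $S$ is eutactic (resp. semi-eutactic) if there are positive (resp. non-negative) numbers $\upsilon_{\mathbf x}=\upsilon_{-\mathbf x}$, $\mathbf x\in S$, with $\mathrm{Id}=\sum_{\mathbf x\in S}\upsilon_{\mathbf x}P_{\mathbf x}$. $S$ is extreme if it is perfect and eutactic; it is minimally extreme if it is extreme and $|S|=n(n+1)$; it is redundantly semi-eutactic (resp. redundantly extreme) if it is extreme and $S\setminus\{\mathbf x,-\mathbf x\}$ is semi-eutactic (resp. extreme) for every $\mathbf x\in S$. A lattice $\Lambda\subset\mathbb R^n$ is said to have one of these properties if the set of its nonzero vectors of minimal norm, scaled to unit length, has it. For a simply laced Dynkin diagram with $n$ nodes, the corresponding root lattice is the lattice in $\mathbb R^n$, unique up to an orthogonal transformation, generated over $\mathbb Z$ by vectors $\mathbf a_1,\dots,\mathbf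 a_n$ with $\langle\mathbf a_i,\mathbf a_i\rangle=1$, $\langle\mathbf a_i,\mathbf a_j\rangle=-\tfrac12$ if the distinct nodes $i,j$ are joined by an edge, and $\langle\mathbf a_i,\mathbf a_j\rangle=0$ otherwise. The Leech lattice is $\Lambda_{24}=L\cup(L+\mathbf x)$, where $$L=\Bigl\{2^{-3/2}\mathbf z:\ \mathbf z\in\mathbb Z^{24},\ \sum_{i=1}^{24}z_i\in4\mathbb Z,\ \mathbf z \bmod 2\in\mathcal C\Bigr\},\qquad \mathbf x=2^{-5/2}(-3,1,1,\dots,1),$$ and $\mathcal C\subset\mathbb F_2^{24}$ is the extended binary Golay code (the cyclic code of length $23$ generated by $1+X^2+X^4+X^5+X^6+X^{10}+X^{11}$, extended by a parity bit). Then: (1) for every $n\ge2$, the root lattice $A_n$ is minimally extreme; (2) for every $n\ge4$, the root lattice $D_n$ is redundantly semi-eutactic but not redundantly extreme; (3) the root lattices $E_6$, $E_7$, $E_8$ and the Leech lattice $\Lambda_{24}$ are redundantly extreme. -/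

import Mathlib

open scoped RealInnerProductSpace

noncomputable section

namespace PerfectEutactic

section Configurations

variable {E : Type*} [NormedAddCommGroup E] [InnerProductSpace ℝ E]

/-- The rank-one map `P_x(y) = ⟨y, x⟩ x`. -/
def proj (x : E) : E →ₗ[ℝ] E where
  toFun y := ⟪y, x⟫ • x
  map_add' y z := by rw [inner_add_left, add_smul]
  map_smul' c y := by simp [real_inner_smul_left, mul_smul]

/-- A finite, origin-symmetric set of unit vectors. -/
structure IsConfiguration (S : Set E) : Prop where
  finite : S.Finite
  norm_eq_one : ∀ x ∈ S, ‖x‖ = 1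
  neg_mem : ∀ x ∈ S, -x ∈ S

/-- The maps `P_x`, `x ∈ S`, span the space of symmetric linear maps. -/
def IsPerfect (S : Set E) : Prop :=
  IsConfiguration S ∧
    ∀ Q : E →ₗ[ℝ] E, Q ∈ Submodule.span ℝ (proj '' S) ↔ Q.IsSymmetric

/-- `v` is a family of eutaxy coefficients for `S` (values outside `S` are irrelevant). -/
def IsEutaxyCoeff (S : Set E) (v : E → ℝ) : Prop :=
  (∀ x ∈ S, v x = v (-x)) ∧ (LinearMap.id : E →ₗ[ℝ] E) = ∑ᶠ x ∈ S, v x • proj x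

def IsEutactic (S : Set E) : Prop :=
  IsConfiguration S ∧ ∃ v : E → ℝ, IsEutaxyCoeff S v ∧ ∀ x ∈ S, 0 < v x

def IsSemiEutactic (S : Set E) : Prop :=
  IsConfiguration S ∧ ∃ v : E → ℝ, IsEutaxyCoeff S v ∧ ∀ x ∈ S, 0 ≤ v x

def IsExtreme (S : Set E) : Prop :=
  IsPerfect S ∧ IsEutactic S

def IsRedundantlySemiEutactic (S : Set E) : Prop :=
  IsExtreme S ∧ ∀ x ∈ S, IsSemiEutactic (S \ {x, -x})

def IsRedundantlyExtreme (S : Set E) : Prop :=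
  IsExtreme S ∧ ∀ x ∈ S, IsExtreme (S \ {x, -x})

/-- Extreme, with exactly `n (n + 1)` vectors, where `n` is the dimension of the space. -/
def IsMinimallyExtreme (S : Set E) : Prop :=
  IsExtreme S ∧ S.ncard = Module.finrank ℝ E * (Module.finrank ℝ E + 1)

/-- The nonzero vectors of `Λ` of least norm. -/
def minimalVectors (Λ : Submodule ℤ E) : Set E :=
  {x | x ∈ Λ ∧ x ≠ 0 ∧ ∀ y ∈ Λ, y ≠ 0 → ⟪x, x⟫ ≤ ⟪y, y⟫}

/-- The minimal vectors of `Λ`, scaled to lie on the unit sphere. -/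
def minimalConfiguration (Λ : Submodule ℤ E) : Set E :=
  (fun x : E => ‖x‖⁻¹ • x) '' minimalVectors Λ

end Configurations

/-- `Λ` is (a copy of) the root lattice in `ℝⁿ` whose simply laced Cartan matrix is `C`: it is
generated over `ℤ` by vectors `a₁, …, aₙ` with `⟨aᵢ, aⱼ⟩ = Cᵢⱼ / 2`, i.e. `1` if `i = j`, `-1/2` if
`i`, `j` are joined in the Dynkin diagram, and `0` otherwise. -/
def IsRootLattice {n : ℕ} (C : Matrix (Fin n) (Fin n) ℤ)
    (Λ : Submodule ℤ (EuclideanSpace ℝ (Fin n))) : Prop :=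
  ∃ a : Fin n → EuclideanSpace ℝ (Fin n),
    (∀ i j, ⟪a i, a j⟫ = (C i j : ℝ) / 2) ∧ Λ = Submodule.span ℤ (Set.range a)

/-- The `j`-th row of the generator matrix of the extended binary Golay code: the coefficients of
`X ^ j * (1 + X² + X⁴ + X⁵ + X⁶ + X¹⁰ + X¹¹)` in positions `0, …, 22`, and a parity bit
(equal to `1`) in position `23`. -/
def golayRow (j : Fin 12) : Fin 24 → ZMod 2 := fun k =>
  if k.val = 23 ∨ k.val ∈ ({0, 2, 4, 5, 6, 10, 11} : Finset ℕ).image (j.val + ·) then 1 else 0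

/-- The extended binary Golay code. -/
def golayCode : Submodule (ZMod 2) (Fin 24 → ZMod 2) :=
  Submodule.span (ZMod 2) (Set.range golayRow)

/-- `L = {2^(-3/2) z : z ∈ ℤ²⁴, ∑ zᵢ ∈ 4ℤ, z mod 2 ∈ golayCode}`. -/
def leechEven : Set (EuclideanSpace ℝ (Fin 24)) :=
  {w | ∃ z : Fin 24 → ℤ, 4 ∣ ∑ i, z i ∧ (∃ c ∈ golayCode, ∀ i, (z i : ZMod 2) = c i) ∧
    w = WithLp.toLp 2 fun i => (2 : ℝ) ^ (-(3 / 2) : ℝ) * (z i : ℝ)}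

/-- `2^(-5/2) (-3, 1, 1, …, 1)`. -/
def leechShift : EuclideanSpace ℝ (Fin 24) :=
  WithLp.toLp 2 fun i => (2 : ℝ) ^ (-(5 / 2) : ℝ) * (if i = 0 then -3 else 1)

theorem leechEven_zero : (0 : EuclideanSpace ℝ (Fin 24)) ∈ leechEven :=
  ⟨0, by simp, ⟨0, golayCode.zero_mem, by simp⟩, by ext i; simp⟩

theorem leechEven_add {v w : EuclideanSpace ℝ (Fin 24)} (hv : v ∈ leechEven)
    (hw : w ∈ leechEven) : v + w ∈ leechEven := by
  obtain ⟨z, hz, ⟨c, hc, hzc⟩, rfl⟩ := hv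
  obtain ⟨z', hz', ⟨c', hc', hzc'⟩, rfl⟩ := hw
  refine ⟨z + z', ?_, ⟨c + c', golayCode.add_mem hc hc', fun i => by simp [hzc, hzc']⟩, ?_⟩
  · simpa [Finset.sum_add_distrib] using dvd_add hz hz'
  · ext i; simp [mul_add]

theorem leechEven_neg {v : EuclideanSpace ℝ (Fin 24)} (hv : v ∈ leechEven) :
    -v ∈ leechEven := by
  obtain ⟨z, hz, ⟨c, hc, hzc⟩, rfl⟩ := hv
  refine ⟨-z, ?_, ⟨-c, golayCode.neg_mem hc, fun i => by simp [hzc]⟩, ?_⟩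
  · simpa using hz
  · ext i; simp

theorem golay_ones : (1 : Fin 24 → ZMod 2) ∈ golayCode := by
  have h : (1 : Fin 24 → ZMod 2) = ∑ j ∈ ({0, 1, 5, 6, 7, 9, 11} : Finset (Fin 12)), golayRow j := by
    decide +kernel
  rw [h]
  exact Submodule.sum_mem _ fun j _ => Submodule.subset_span ⟨j, rfl⟩

theorem leechShift_add_self : leechShift + leechShift ∈ leechEven := by
  refine ⟨fun i => if i = 0 then -3 else 1, by decide, ⟨1, golay_ones, ?_⟩, ?_⟩
  · intro i; by_cases h : i = 0 <;> simp [h]; decide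
  · have h2 : (2 : ℝ) ^ (-(3 / 2) : ℝ) = 2 * (2 : ℝ) ^ (-(5 / 2) : ℝ) := by
      rw [← Real.rpow_one_add' (by norm_num) (by norm_num)]; norm_num
    ext i
    by_cases h : i = 0 <;> simp [leechShift, h, h2] <;> ring

/-- The Leech lattice `L ∪ (L + x)`, with `L = leechEven` and `x = leechShift`. -/
def leechLattice : Submodule ℤ (EuclideanSpace ℝ (Fin 24)) :=
  AddSubgroup.toIntSubmodule
    { carrier := leechEven ∪ (fun w => w + leechShift) '' leechEven
      zero_mem' := Or.inl leechEven_zero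
      add_mem' := by
        rintro _ _ (hv | ⟨v, hv, rfl⟩) (hw | ⟨w, hw, rfl⟩)
        · exact Or.inl (leechEven_add hv hw)
        · exact Or.inr ⟨_, leechEven_add hv hw, by simp only; abel⟩
        · exact Or.inr ⟨_, leechEven_add hv hw, by simp only; abel⟩
        · refine Or.inl ?_
          have h := leechEven_add (leechEven_add hv hw) leechShift_add_self
          convert h using 1
          simp only; abel
      neg_mem' := by
        rintro _ (hv | ⟨v, hv, rfl⟩)
        · exact Or.inl (leechEven_neg hv)
        · refine Or.inr ⟨_, leechEven_neg (leechEven_add hv leechShift_add_self), ?_⟩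
          simp only; abel }

end PerfectEutactic

end

open PerfectEutactic

/-! Perfection is checked by polarisation. The operators `symmProd a b` with `a`, `b` in a spanning
family span the symmetric maps, and each is a combination of a few `P_x` once suitable sums or
differences of lattice vectors are again minimal.

Eutaxy of a root lattice comes from symmetry. The roots are closed under their own reflections, so
`∑ P_x` has every root as an eigenvector and commutes with every `P_x`. By perfection it commutes
with all symmetric maps, hence is a positive multiple of `Id` (`exists_id_eq_smul_sum`).

Removing a pair `±x` uses an exchange. If `f` is an orthonormal quadruple with `f 0 = x` whose
half-sum lies in the lattice, half a Hadamard matrix turns `f` into four other minimal vectors with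
the same sum of projections. Trading one quadruple for the other writes `Id` without `P_x`, so the
rest is semi-eutactic. The trade leaves zero weight on `f 1`, `f 2`, `f 3`. A second quadruple
through `x`, otherwise disjoint from the first up to sign, keeps those weights positive. Then `Id`
is interior to the cone of the remaining projections, and the rest is extreme
(`isExtreme_of_frames`).

For `E₆`, `E₇`, `E₈` one explicit pair of quadruples at a simple root is carried to all roots by
reflections. In `D_n` the exchange still gives semi-eutaxy, but without `±(w 0 + w 1)` the form `Q ↦
⟨Q (w 0), w 1⟩` is non-positive on all remaining projections, negative on one of them and zero on
`Id`, which excludes eutaxy. In `A_n` it remains to count the `n (n + 1)` differences of vertices of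
a simplex. The Leech lattice contains a copy of `D₂₄`, already extreme. A pair outside it can be
dropped at once, and a pair inside it lies over an octad of the Golay code, which supplies the two
quadruples. -/

namespace PerfectEutactic

/-! ### Polarisation, the cone of projections, and eutaxy from reflections. -/

section General

variable {E : Type*} [NormedAddCommGroup E] [InnerProductSpace ℝ E]

theorem proj_apply (x y : E) : proj x y = ⟪y, x⟫ • x := rfl

@[simp]
theorem proj_neg (x : E) : proj (-x) = proj x := by
  ext y; simp [proj_apply]

theorem proj_isSymmetric (x : E) : (proj x).IsSymmetric := fun y z => by
  simp only [proj_apply, real_inner_smul_left, real_inner_smul_right]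
  rw [real_inner_comm x z, mul_comm]

/-- The symmetrised rank-two map `y ↦ ⟨y, a⟩ b + ⟨y, b⟩ a`, bilinear in `a` and `b`. -/
noncomputable def symmProd : E →ₗ[ℝ] E →ₗ[ℝ] E →ₗ[ℝ] E :=
  LinearMap.mk₂ ℝ
    (fun a b =>
      { toFun := fun y => ⟪y, a⟫ • b + ⟪y, b⟫ • a
        map_add' := fun y z => by simp only [inner_add_left]; module
        map_smul' := fun c y => by
          simp only [real_inner_smul_left, RingHom.id_apply]; module })
    (fun a a' b => by ext y; simp [inner_add_right]; module)
    (fun c a b => by ext y; simp [real_inner_smul_right]; module)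
    (fun a b b' => by ext y; simp [inner_add_right]; module)
    (fun c a b => by ext y; simp [real_inner_smul_right]; module)

theorem symmProd_apply (a b y : E) : symmProd a b y = ⟪y, a⟫ • b + ⟪y, b⟫ • a := rfl

theorem symmProd_self (a : E) : symmProd a a = (2 : ℝ) • proj a := by
  ext y; simp only [symmProd_apply, proj_apply, LinearMap.smul_apply]; module

theorem proj_add (a b : E) : proj (a + b) = proj a + proj b + symmProd a b := by
  ext y; simp only [symmProd_apply, proj_apply, LinearMap.add_apply, inner_add_right]; module

theorem proj_sub (a b : E) : proj (a - b) = proj a + proj b - symmProd a b := by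
  ext y
  simp only [symmProd_apply, proj_apply, LinearMap.add_apply, LinearMap.sub_apply, inner_sub_right]
  module

theorem symmProd_mem_of_span_eq_top {ι : Type*} {p : ι → E}
    (hp : Submodule.span ℝ (Set.range p) = ⊤) {W : Submodule ℝ (E →ₗ[ℝ] E)}
    (h : ∀ i j, symmProd (p i) (p j) ∈ W) (a b : E) : symmProd a b ∈ W := by
  have h1 : ∀ i, ∀ b, symmProd (p i) b ∈ W := fun i b => by
    have : Submodule.span ℝ (Set.range p) ≤ W.comap (symmProd (p i)) :=
      Submodule.span_le.2 (by rintro _ ⟨j, rfl⟩; exact h i j)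
    exact this (hp ▸ Submodule.mem_top)
  have : Submodule.span ℝ (Set.range p) ≤ W.comap (symmProd.flip b) :=
    Submodule.span_le.2 (by rintro _ ⟨j, rfl⟩; exact h1 j b)
  exact this (hp ▸ Submodule.mem_top)

/-- A symmetric `Q` equals `½ ∑ symmProd (e i) (Q (e i))` for any orthonormal basis `e`: one half of
each term reassembles `Q`, the other its adjoint. -/
theorem mem_of_isSymmetric [FiniteDimensional ℝ E] {W : Submodule ℝ (E →ₗ[ℝ] E)}
    (h : ∀ a b, symmProd a b ∈ W) {Q : E →ₗ[ℝ] E} (hQ : Q.IsSymmetric) : Q ∈ W := by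
  let e := stdOrthonormalBasis ℝ E
  have : Q = (1 / 2 : ℝ) • ∑ i, symmProd (e i) (Q (e i)) := by
    ext y
    have h1 : ∑ i, ⟪y, e i⟫ • Q (e i) = Q y := by
      conv_rhs => rw [← e.sum_repr' y, map_sum]
      exact Finset.sum_congr rfl fun i _ => by rw [map_smul, real_inner_comm]
    have h2 : ∑ i, ⟪y, Q (e i)⟫ • e i = Q y := by
      conv_rhs => rw [← e.sum_repr' (Q y)]
      exact Finset.sum_congr rfl fun i _ => by rw [← hQ, real_inner_comm]
    simp only [LinearMap.smul_apply, LinearMap.sum_apply, symmProd_apply, Finset.sum_add_distrib,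
      h1, h2]
    module
  rw [this]
  exact W.smul_mem _ (W.sum_mem fun i _ => h _ _)

theorem span_proj_isSymmetric {S : Set E} {Q : E →ₗ[ℝ] E}
    (hQ : Q ∈ Submodule.span ℝ (proj '' S)) : Q.IsSymmetric := by
  induction hQ using Submodule.span_induction with
  | mem x h => obtain ⟨x, -, rfl⟩ := h; exact proj_isSymmetric x
  | zero => intro x y; simp
  | add x y _ _ hx hy => exact hx.add hy
  | smul a x _ hx => exact hx.smul (by simp)

theorem isPerfect_of_symmProd_mem [FiniteDimensional ℝ E] {S : Set E} (hS : IsConfiguration S)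
    {ι : Type*} {p : ι → E} (hp : Submodule.span ℝ (Set.range p) = ⊤)
    (h : ∀ i j, symmProd (p i) (p j) ∈ Submodule.span ℝ (proj '' S)) : IsPerfect S :=
  ⟨hS, fun _ => ⟨span_proj_isSymmetric,
    mem_of_isSymmetric (symmProd_mem_of_span_eq_top hp h)⟩⟩

theorem proj_mem_span {S : Set E} {x : E} (hx : x ∈ S) :
    proj x ∈ Submodule.span ℝ (proj '' S) :=
  Submodule.subset_span ⟨x, hx, rfl⟩

theorem symmProd_mem_span_of_add_mem {S : Set E} {a b : E} (ha : a ∈ S) (hb : b ∈ S)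
    (hab : a + b ∈ S) : symmProd a b ∈ Submodule.span ℝ (proj '' S) := by
  rw [show symmProd a b = proj (a + b) - proj a - proj b by rw [proj_add]; abel]
  exact sub_mem (sub_mem (proj_mem_span hab) (proj_mem_span ha)) (proj_mem_span hb)

theorem symmProd_mem_span_of_sub_mem {S : Set E} {a b : E} (ha : a ∈ S) (hb : b ∈ S)
    (hab : a - b ∈ S) : symmProd a b ∈ Submodule.span ℝ (proj '' S) := by
  rw [show symmProd a b = proj a + proj b - proj (a - b) by rw [proj_sub]; abel]
  exact sub_mem (add_mem (proj_mem_span ha) (proj_mem_span hb)) (proj_mem_span hab)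

/-- Two orthogonal roots `a`, `b` at the ends of a chain `a`, `t`, `b` of roots. -/
theorem symmProd_mem_span_of_chain {S : Set E} {a b t : E} (ht : t ∈ S) (hat : a + t ∈ S)
    (htb : t + b ∈ S) (hatb : a + t + b ∈ S) :
    symmProd a b ∈ Submodule.span ℝ (proj '' S) := by
  rw [show symmProd a b = proj (a + t + b) + proj t - proj (a + t) - proj (t + b) by
    simp only [proj_add, map_add, LinearMap.add_apply]; abel]
  exact sub_mem (sub_mem (add_mem (proj_mem_span hatb) (proj_mem_span ht)) (proj_mem_span hat))
    (proj_mem_span htb)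

/-- The cone of non-negative combinations of the maps `P_x`, `x ∈ S`. -/
noncomputable abbrev projCone (S : Set E) : PointedCone ℝ (E →ₗ[ℝ] E) :=
  PointedCone.hull ℝ (proj '' S)

theorem proj_mem_projCone {S : Set E} {x : E} (hx : x ∈ S) : proj x ∈ projCone S :=
  Submodule.subset_span ⟨x, hx, rfl⟩

theorem smul_mem_projCone {S : Set E} {Q : E →ₗ[ℝ] E} (hQ : Q ∈ projCone S) {c : ℝ}
    (hc : 0 ≤ c) : c • Q ∈ projCone S :=
  (projCone S).smul_mem hc hQ

/-- Cone membership ignores the requirement that coefficients agree at `x` and `-x`. Since `P_x =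
P_{-x}`, averaging over the pair restores it. -/
theorem exists_symmetric_coeff {S : Set E} (hS : IsConfiguration S) {Q : E →ₗ[ℝ] E}
    (hQ : Q ∈ projCone S) : ∃ v : E → ℝ, (∀ x, v x = v (-x)) ∧ (∀ x, 0 ≤ v x) ∧
      Q = ∑ x ∈ hS.finite.toFinset, v x • proj x := by
  classical
  induction hQ using Submodule.span_induction with
  | mem x h =>
    obtain ⟨x, hx, rfl⟩ := h
    refine ⟨fun y => 1 / 2 * ((if y = x then 1 else 0) + if y = -x then 1 else 0), fun y => ?_,
      fun y => by positivity, ?_⟩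
    · simp only [neg_eq_iff_eq_neg, neg_neg]; ring
    · simp only [mul_smul, add_smul, ite_smul, one_smul, zero_smul, ← Finset.smul_sum,
        Finset.sum_add_distrib, Finset.sum_ite_eq']
      rw [if_pos (by simpa using hx), if_pos (by simpa using hS.neg_mem x hx), proj_neg]
      module
  | zero => exact ⟨0, by simp, by simp, by simp⟩
  | add x y _ _ hx hy =>
    obtain ⟨v, h1, h2, rfl⟩ := hx
    obtain ⟨w, h3, h4, rfl⟩ := hy
    exact ⟨v + w, fun x => by simp [h1 x, h3 x], fun x => add_nonneg (h2 x) (h4 x),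
      by simp [add_smul, Finset.sum_add_distrib]⟩
  | smul a x _ hx =>
    obtain ⟨v, h1, h2, rfl⟩ := hx
    refine ⟨fun x => a * v x, fun x => by simp [h1 x], fun x => mul_nonneg a.2 (h2 x), ?_⟩
    simp only [mul_smul, ← Finset.smul_sum]
    rfl

theorem finsum_mem_smul_proj {S : Set E} (hS : S.Finite) (v : E → ℝ) :
    ∑ᶠ x ∈ S, v x • proj x = ∑ x ∈ hS.toFinset, v x • proj x :=
  finsum_mem_eq_finite_toFinset_sum _ hS

theorem isSemiEutactic_of_id_mem {S : Set E} (hS : IsConfiguration S)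
    (h : LinearMap.id ∈ projCone S) : IsSemiEutactic S := by
  obtain ⟨v, h1, h2, h3⟩ := exists_symmetric_coeff hS h
  exact ⟨hS, v, ⟨fun x _ => h1 x, by rw [finsum_mem_smul_proj hS.finite]; exact h3⟩,
    fun x _ => h2 x⟩

theorem isEutactic_of_sub_sum_mem {S : Set E} (hS : IsConfiguration S) {ε : ℝ} (hε : 0 < ε)
    (h : LinearMap.id - ε • ∑ x ∈ hS.finite.toFinset, proj x ∈ projCone S) : IsEutactic S := by
  obtain ⟨v, h1, h2, h3⟩ := exists_symmetric_coeff hS h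
  refine ⟨hS, fun x => v x + ε, ⟨fun x _ => by simp [h1 x], ?_⟩,
    fun x _ => add_pos_of_nonneg_of_pos (h2 x) hε⟩
  rw [finsum_mem_smul_proj hS.finite]
  simp only [add_smul, Finset.sum_add_distrib, ← h3, ← Finset.smul_sum]
  abel

/-- If a little of each `P_y` can be subtracted from `Id` inside the cone, then `Id` is an interior
point of the cone in every direction of the span of these `P_y`. -/
theorem id_add_smul_mem_projCone {T Y : Set E} (hYT : Y ⊆ T)
    (hid : LinearMap.id ∈ projCone T)
    (hY : ∀ y ∈ Y, ∃ ε : ℝ, 0 < ε ∧ LinearMap.id - ε • proj y ∈ projCone T)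
    {Q : E →ₗ[ℝ] E} (hQ : Q ∈ Submodule.span ℝ (proj '' Y)) :
    ∃ ε : ℝ, 0 < ε ∧ ∀ t : ℝ, |t| ≤ ε → LinearMap.id + t • Q ∈ projCone T := by
  induction hQ using Submodule.span_induction with
  | mem x h =>
    obtain ⟨y, hy, rfl⟩ := h
    obtain ⟨ε, hε, h⟩ := hY y hy
    refine ⟨ε, hε, fun t ht => ?_⟩
    have := add_mem h (smul_mem_projCone (proj_mem_projCone (hYT hy))
      (show 0 ≤ ε + t by linarith [neg_abs_le t]))
    convert this using 1
    module
  | zero => exact ⟨1, one_pos, fun t _ => by simpa using hid⟩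
  | add x y _ _ hx hy =>
    obtain ⟨ε, hε, h⟩ := hx
    obtain ⟨δ, hδ, h'⟩ := hy
    -- `Id + t (x + y)` is the midpoint of `Id + 2t x` and `Id + 2t y`.
    refine ⟨min ε δ / 2, by positivity, fun t ht => ?_⟩
    have h2 : |2 * t| ≤ min ε δ := by rw [abs_mul, abs_two]; linarith
    have := smul_mem_projCone (add_mem (h _ (h2.trans (min_le_left _ _)))
      (h' _ (h2.trans (min_le_right _ _)))) (show (0 : ℝ) ≤ 1 / 2 by norm_num)
    convert this using 1
    module
  | smul a x _ hx =>
    obtain ⟨ε, hε, h⟩ := hx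
    -- The summand `1` covers `a = 0`.
    refine ⟨ε / (|a| + 1), by positivity, fun t ht => ?_⟩
    rw [smul_smul]
    apply h
    rw [abs_mul]
    rw [le_div_iff₀ (by positivity)] at ht
    nlinarith [abs_nonneg t]

/-- Positive coefficients are needed on all of `T`, but interiority need only be tested on a
spanning part `Y`: the sum of all `P_x`, `x ∈ T`, is symmetric, so it lies in the span of `Y` and a
small multiple of it can be split off from `Id`. -/
theorem isExtreme_of_subset {T Y : Set E} (hT : IsConfiguration T) (hYT : Y ⊆ T)
    (hspan : ∀ Q : E →ₗ[ℝ] E, Q.IsSymmetric → Q ∈ Submodule.span ℝ (proj '' Y))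
    (hid : LinearMap.id ∈ projCone T)
    (hY : ∀ y ∈ Y, ∃ ε : ℝ, 0 < ε ∧ LinearMap.id - ε • proj y ∈ projCone T) : IsExtreme T := by
  refine ⟨⟨hT, fun Q => ⟨span_proj_isSymmetric, fun h =>
    Submodule.span_mono (Set.image_mono hYT) (hspan Q h)⟩⟩, ?_⟩
  have hsum : (∑ x ∈ hT.finite.toFinset, proj x) ∈ Submodule.span ℝ (proj '' Y) :=
    Submodule.sum_mem _ fun x _ => hspan _ (proj_isSymmetric x)
  obtain ⟨ε, hε, h⟩ := id_add_smul_mem_projCone hYT hid hY hsum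
  refine isEutactic_of_sub_sum_mem hT hε ?_
  rw [sub_eq_add_neg, ← neg_smul]
  exact h _ (by rw [abs_neg, abs_of_pos hε])

/-- In a perfect configuration closed under its own reflections, `∑ P_x` is a multiple of `Id`. -/
theorem exists_id_eq_smul_sum [Nontrivial E] {S : Set E} (hS : IsPerfect S)
    (hrefl : ∀ x ∈ S, ∀ y ∈ S, y - (2 * ⟪y, x⟫) • x ∈ S) :
    ∃ c : ℝ, 0 < c ∧ LinearMap.id = c • ∑ x ∈ hS.1.finite.toFinset, proj x := by
  set F := hS.1.finite.toFinset with hF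
  have hmem : ∀ x, x ∈ F ↔ x ∈ S := fun x => by simp [hF]
  set T : E →ₗ[ℝ] E := ∑ x ∈ F, proj x with hT
  have hTapp : ∀ y, T y = ∑ x ∈ F, ⟪y, x⟫ • x := fun y => by
    simp [hT, proj_apply]
  have hTsymm : T.IsSymmetric :=
    span_proj_isSymmetric (Submodule.sum_mem _ fun x hx => proj_mem_span ((hmem x).1 hx))
  have heig : ∀ x ∈ S, T x = (∑ y ∈ F, ⟪x, y⟫ ^ 2) • x := fun x hx => by
    have hxx : ⟪x, x⟫ = 1 := by rw [real_inner_self_eq_norm_sq, hS.1.norm_eq_one x hx]; norm_num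
    have hinv : ∀ y : E, y - (2 * ⟪y, x⟫) • x -
        (2 * ⟪y - (2 * ⟪y, x⟫) • x, x⟫) • x = y := fun y => by
      rw [inner_sub_left, real_inner_smul_left, hxx]; module
    -- The reflection in `x` permutes `F` and changes the sign of `⟪x, ·⟫`. Expanding the reflected
    -- sum gives `T x = -T x + 2 (∑ ⟪x, y⟫²) x`.
    have key : ∑ y ∈ F, ⟪x, y⟫ • y = ∑ y ∈ F, (-⟪x, y⟫) • (y - (2 * ⟪y, x⟫) • x) := by
      refine Finset.sum_nbij' (fun y => y - (2 * ⟪y, x⟫) • x) (fun y => y - (2 * ⟪y, x⟫) • x)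
        ?_ ?_ ?_ ?_ ?_
      · intro y hy; exact (hmem _).2 (hrefl x hx y ((hmem y).1 hy))
      · intro y hy; exact (hmem _).2 (hrefl x hx y ((hmem y).1 hy))
      · intro y _; exact hinv y
      · intro y _; exact hinv y
      · intro y _
        simp only [hinv]
        congr 1
        rw [inner_sub_right, real_inner_smul_right, hxx, real_inner_comm x y]; ring
    have key2 : ∑ y ∈ F, (-⟪x, y⟫) • (y - (2 * ⟪y, x⟫) • x) =
        -T x + (2 : ℝ) • (∑ y ∈ F, ⟪x, y⟫ ^ 2) • x := by
      rw [hTapp, Finset.sum_smul, Finset.smul_sum, ← Finset.sum_neg_distrib,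
        ← Finset.sum_add_distrib]
      refine Finset.sum_congr rfl fun y _ => ?_
      rw [real_inner_comm x y]; module
    rw [← hTapp, key2] at key
    have : (2 : ℝ) • T x = (2 : ℝ) • (∑ y ∈ F, ⟪x, y⟫ ^ 2) • x := by
      rw [two_smul]; nth_rewrite 1 [key]; abel
    exact smul_right_injective E (two_ne_zero' ℝ) this
  -- Commuting with `P_x` says that `x` is an eigenvector of the symmetric map `T`; perfection
  -- extends this to all symmetric maps.
  have hcomm : ∀ Q ∈ Submodule.span ℝ (proj '' S), ∀ y, T (Q y) = Q (T y) := by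
    intro Q hQ
    induction hQ using Submodule.span_induction with
    | mem Q h =>
      obtain ⟨x, hx, rfl⟩ := h
      intro y
      rw [proj_apply, proj_apply, map_smul, heig x hx, hTsymm y x, heig x hx,
        real_inner_smul_right, smul_smul, mul_comm]
    | zero => simp
    | add P Q _ _ hP hQ => intro y; simp [hP, hQ]
    | smul a Q _ hQ => intro y; simp [hQ]
  -- Commuting with `P_v` makes `T v` parallel to `v`, for every `v`.
  obtain ⟨a, ha⟩ := LinearMap.exists_eq_smul_id_of_forall_notLinearIndependent (f := T) (by
    intro v hv
    have h := hcomm (proj v) ((hS.2 _).2 (proj_isSymmetric v)) v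
    rw [proj_apply, proj_apply, map_smul] at h
    have h' := LinearIndependent.pair_iff.1 hv (-⟪T v, v⟫) ⟪v, v⟫ (by rw [h]; module)
    have hv0 : v ≠ 0 := by simpa using hv.ne_zero 0
    exact hv0 (inner_self_eq_zero.1 h'.2))
  have hne : S.Nonempty := by
    by_contra hne
    rw [Set.not_nonempty_iff_eq_empty] at hne
    have := (hS.2 LinearMap.id).2 LinearMap.IsSymmetric.id
    rw [hne, Set.image_empty, Submodule.span_empty, Submodule.mem_bot] at this
    obtain ⟨v, hv⟩ := exists_ne (0 : E)
    exact hv (by simpa using LinearMap.congr_fun this v)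
  obtain ⟨x, hx⟩ := hne
  have hxx : ⟪x, x⟫ = 1 := by rw [real_inner_self_eq_norm_sq, hS.1.norm_eq_one x hx]; norm_num
  have hpos : 0 < a := by
    have h1 := heig x hx
    rw [ha, LinearMap.smul_apply, Module.End.one_apply] at h1
    have h2 := congrArg (fun z => ⟪z, x⟫) h1
    simp only [real_inner_smul_left, hxx, mul_one] at h2
    rw [h2]
    exact Finset.sum_pos' (fun _ _ => sq_nonneg _) ⟨x, (hmem x).2 hx, by rw [hxx]; norm_num⟩
  refine ⟨a⁻¹, inv_pos.2 hpos, ?_⟩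
  rw [ha, smul_smul, inv_mul_cancel₀ hpos.ne', one_smul]
  rfl

end General

/-! ### The frame exchange. -/

section Frames

variable {E : Type*} [NormedAddCommGroup E] [InnerProductSpace ℝ E]

/-- The image of the frame `f` under half the Hadamard matrix of order `4`. -/
noncomputable def halfFrame (f : Fin 4 → E) : Fin 4 → E :=
  ![(1 / 2 : ℝ) • (f 0 + f 1 + f 2 + f 3), (1 / 2 : ℝ) • (f 0 + f 1 - f 2 - f 3),
    (1 / 2 : ℝ) • (f 0 - f 1 + f 2 - f 3), (1 / 2 : ℝ) • (f 0 - f 1 - f 2 + f 3)]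

/-- Half a Hadamard matrix of order four is orthogonal, and `∑ P_{f i}` is unchanged under an
orthogonal recombination of the `f i`. -/
theorem sum_proj_halfFrame (f : Fin 4 → E) :
    ∑ i, proj (halfFrame f i) = ∑ i, proj (f i) := by
  ext y
  simp only [halfFrame, Fin.sum_univ_four, LinearMap.add_apply, proj_apply, Matrix.cons_val,
    real_inner_smul_right, inner_add_right, inner_sub_right]
  module

/-- The factor `2` appears because `f i` and `-f i` both occur in `F` with the same projection;
orthonormality makes these eight vectors distinct. -/
theorem sum_frame_add_sum_compl [DecidableEq E] {f : Fin 4 → E} (hf : Orthonormal ℝ f)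
    {F : Finset E} (hfF : ∀ i, f i ∈ F) (hneg : ∀ i, -f i ∈ F) :
    ∑ x ∈ F, proj x = (2 : ℝ) • ∑ i, proj (f i) +
      ∑ x ∈ F.filter (fun x => ∀ i, x ≠ f i ∧ x ≠ -f i), proj x := by
  have hinj : Function.Injective f := hf.linearIndependent.injective
  have hdisj : ∀ i j, f i ≠ -f j := fun i j h => by
    have h1 : ⟪f i, f i⟫ = 1 := by rw [real_inner_self_eq_norm_sq, hf.1 i]; norm_num
    by_cases hij : i = j
    · subst hij
      nth_rewrite 2 [h] at h1
      rw [inner_neg_right, real_inner_self_eq_norm_sq, hf.1 i] at h1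
      norm_num at h1
    · nth_rewrite 2 [h] at h1
      rw [inner_neg_right, hf.2 hij] at h1
      norm_num at h1
  have hN : F.filter (fun x => ¬ ∀ i, x ≠ f i ∧ x ≠ -f i) =
      Finset.univ.image f ∪ Finset.univ.image (fun i => -f i) := by
    ext x
    simp only [Finset.mem_filter, Finset.mem_union, Finset.mem_image, Finset.mem_univ, true_and]
    constructor
    · rintro ⟨-, h⟩
      push Not at h
      obtain ⟨i, hi⟩ := h
      by_cases hx : x = f i
      · exact Or.inl ⟨i, hx.symm⟩
      · exact Or.inr ⟨i, (hi hx).symm⟩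
    · rintro (⟨i, rfl⟩ | ⟨i, rfl⟩)
      · exact ⟨hfF i, fun h => (h i).1 rfl⟩
      · exact ⟨hneg i, fun h => (h i).2 rfl⟩
  rw [← Finset.sum_filter_not_add_sum_filter F (fun x => ∀ i, x ≠ f i ∧ x ≠ -f i), hN,
    Finset.sum_union, Finset.sum_image hinj.injOn,
    Finset.sum_image (fun i _ j _ h => hinj (neg_injective h))]
  · simp [two_smul]
  · rw [Finset.disjoint_left]
    simp only [Finset.mem_image, Finset.mem_univ, true_and]
    rintro _ ⟨i, rfl⟩ ⟨j, hj⟩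
    exact hdisj i j hj.symm

section Exchange

variable {D T : Set E} (hD : IsConfiguration D) {c : ℝ} (hc : 0 < c)
  (hid : LinearMap.id = c • ∑ x ∈ hD.finite.toFinset, proj x) {f : Fin 4 → E}
  (hf : Orthonormal ℝ f) (hfD : ∀ i, f i ∈ D) (hgT : ∀ i, halfFrame f i ∈ T)
  (hDT : ∀ x ∈ D, x ≠ f 0 → x ≠ -f 0 → x ∈ T)

include hc hid hf hfD hgT hDT

/-- Exchanging the frame `f` for `halfFrame f` in the eutaxy relation. -/
theorem id_mem_projCone_of_frame : LinearMap.id ∈ projCone T := by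
  classical
  rw [hid, sum_frame_add_sum_compl hf (F := hD.finite.toFinset) (by simpa using hfD)
    (by simpa using fun i => hD.neg_mem _ (hfD i)), ← sum_proj_halfFrame]
  refine smul_mem_projCone (add_mem (smul_mem_projCone
    (sum_mem fun i _ => proj_mem_projCone (hgT i)) zero_le_two) (sum_mem fun x hx => ?_)) hc.le
  simp only [Finset.mem_filter, Set.Finite.mem_toFinset] at hx
  exact proj_mem_projCone (hDT x hx.1 (hx.2 0).1 (hx.2 0).2)

/-- A vector off the frame keeps its weight `c` in the exchanged relation, so that weight may be
subtracted. -/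
theorem id_sub_smul_mem_projCone_of_frame {y : E} (hy : y ∈ D)
    (hyf : ∀ i, y ≠ f i ∧ y ≠ -f i) : LinearMap.id - c • proj y ∈ projCone T := by
  classical
  have hy' : y ∈ hD.finite.toFinset.filter (fun x => ∀ i, x ≠ f i ∧ x ≠ -f i) := by
    simpa using ⟨hy, hyf⟩
  rw [hid, sum_frame_add_sum_compl hf (F := hD.finite.toFinset) (by simpa using hfD)
    (by simpa using fun i => hD.neg_mem _ (hfD i)), ← sum_proj_halfFrame,
    ← Finset.add_sum_erase _ _ hy', ← smul_sub, add_sub_assoc, add_sub_cancel_left]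
  refine smul_mem_projCone (add_mem (smul_mem_projCone
    (sum_mem fun i _ => proj_mem_projCone (hgT i)) zero_le_two) (sum_mem fun x hx => ?_)) hc.le
  simp only [Finset.mem_erase, Finset.mem_filter, Set.Finite.mem_toFinset] at hx
  exact proj_mem_projCone (hDT x hx.2.1 (hx.2.2 0).1 (hx.2.2 0).2)

/-- The exchanged vectors enter with weight `2c`, so one `c` can be spared. -/
theorem id_sub_smul_halfFrame_mem_projCone (i : Fin 4) :
    LinearMap.id - c • proj (halfFrame f i) ∈ projCone T := by
  classical
  rw [hid, sum_frame_add_sum_compl hf (F := hD.finite.toFinset) (by simpa using hfD)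
    (by simpa using fun i => hD.neg_mem _ (hfD i)), ← sum_proj_halfFrame, ← smul_sub, two_smul]
  nth_rewrite 2 [← Finset.add_sum_erase _ _ (Finset.mem_univ i)]
  rw [show ∀ a b d e : E →ₗ[ℝ] E, a + (b + d) + e - b = a + d + e by intros; abel]
  refine smul_mem_projCone (add_mem (add_mem (sum_mem fun i _ => proj_mem_projCone (hgT i))
    (sum_mem fun i _ => proj_mem_projCone (hgT i))) (sum_mem fun x hx => ?_)) hc.le
  simp only [Finset.mem_filter, Set.Finite.mem_toFinset] at hx
  exact proj_mem_projCone (hDT x hx.1 (hx.2 0).1 (hx.2 0).2)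

end Exchange

/-- With one frame, nothing can be subtracted at `f 1`, `f 2`, `f 3`. A second frame sharing only
`±f 0` keeps weight on those, so every vector of the spanning part is covered by one frame or the
other. -/
theorem isExtreme_of_frames {D T : Set E} (hD : IsPerfect D) (hT : IsConfiguration T) {c : ℝ}
    (hc : 0 < c) (hid : LinearMap.id = c • ∑ x ∈ hD.1.finite.toFinset, proj x)
    {f f' : Fin 4 → E} (hf : Orthonormal ℝ f) (hf' : Orthonormal ℝ f') (h0 : f' 0 = f 0)
    (hfD : ∀ i, f i ∈ D) (hfD' : ∀ i, f' i ∈ D) (hgT : ∀ i, halfFrame f i ∈ T)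
    (hgT' : ∀ i, halfFrame f' i ∈ T) (hDT : ∀ x ∈ D, x ≠ f 0 → x ≠ -f 0 → x ∈ T)
    (hne : ∀ i j, i ≠ 0 → j ≠ 0 → f i ≠ f' j ∧ f i ≠ -f' j) : IsExtreme T := by
  have hf0 : ∀ i, i ≠ 0 → f i ≠ f 0 ∧ f i ≠ -f 0 := fun i hi => by
    have h1 : ⟪f 0, f 0⟫ = 1 := by rw [real_inner_self_eq_norm_sq, hf.1 0]; norm_num
    have h2 : ⟪f i, f 0⟫ = 0 := hf.2 hi
    constructor <;> intro h <;> rw [h] at h2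
    · linarith
    · rw [inner_neg_left] at h2; linarith
  refine isExtreme_of_subset (Y := {x ∈ D | x ≠ f 0 ∧ x ≠ -f 0} ∪ Set.range (halfFrame f)) hT
    ?_ ?_ (id_mem_projCone_of_frame hD.1 hc hid hf hfD hgT hDT) ?_
  · rintro x (⟨hx, h1, h2⟩ | ⟨i, rfl⟩)
    · exact hDT x hx h1 h2
    · exact hgT i
  · intro Q hQ
    have hle : Submodule.span ℝ (proj '' D) ≤ Submodule.span ℝ
        (proj '' ({x ∈ D | x ≠ f 0 ∧ x ≠ -f 0} ∪ Set.range (halfFrame f))) := by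
      rw [Submodule.span_le]
      -- The equality of the two frame sums recovers `P_{f 0}` from the half-frame and the other
      -- three frame vectors, so dropping `±f 0` does not shrink the span.
      have hx0 : proj (f 0) ∈ Submodule.span ℝ
          (proj '' ({x ∈ D | x ≠ f 0 ∧ x ≠ -f 0} ∪ Set.range (halfFrame f))) := by
        have h := sum_proj_halfFrame f
        rw [← Finset.add_sum_erase _ (fun i => proj (f i)) (Finset.mem_univ 0)] at h
        rw [← sub_eq_of_eq_add h]
        refine sub_mem (sum_mem fun i _ => proj_mem_span (Or.inr ⟨i, rfl⟩))
          (sum_mem fun i hi => proj_mem_span (Or.inl ⟨hfD i, hf0 i (by simpa using hi)⟩))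
      rintro _ ⟨x, hx, rfl⟩
      by_cases h1 : x = f 0
      · rw [h1]; exact hx0
      by_cases h2 : x = -f 0
      · rw [h2, proj_neg]; exact hx0
      exact proj_mem_span (Or.inl ⟨hx, h1, h2⟩)
    exact hle ((hD.2 Q).2 hQ)
  · rintro y (⟨hy, h1, h2⟩ | ⟨i, rfl⟩)
    · refine ⟨c, hc, ?_⟩
      -- A vector on the first frame other than `±f 0` is off the second, and there the second
      -- exchange applies.
      by_cases hyf : ∀ i, y ≠ f i ∧ y ≠ -f i
      · exact id_sub_smul_mem_projCone_of_frame hD.1 hc hid hf hfD hgT hDT hy hyf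
      · refine id_sub_smul_mem_projCone_of_frame hD.1 hc hid hf' hfD' hgT'
          (by rwa [h0]) hy fun j => ?_
        rcases eq_or_ne j 0 with rfl | hj
        · rw [h0]; exact ⟨h1, h2⟩
        · push Not at hyf
          obtain ⟨i, hi⟩ := hyf
          have hi0 : i ≠ 0 := by rintro rfl; exact h2 (hi h1)
          obtain ⟨h3, h4⟩ := hne i j hi0 hj
          by_cases h5 : y = f i
          · rw [h5]; exact ⟨h3, h4⟩
          · rw [hi h5]
            exact ⟨fun h => h4 (by rw [← h, neg_neg]), fun h => h3 (neg_injective h)⟩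
    · exact ⟨c, hc, id_sub_smul_halfFrame_mem_projCone hD.1 hc hid hf hfD hgT hDT i⟩

end Frames

/-! ### Vectors of norm one in half-integral lattices, and frame pairs. -/

section Lattices

variable {E : Type*} [NormedAddCommGroup E] [InnerProductSpace ℝ E]

/-- The vectors of norm one in a lattice. -/
def unitVectors (Λ : Submodule ℤ E) : Set E := {x | x ∈ Λ ∧ ‖x‖ = 1}

theorem inner_self_of_mem_unitVectors {Λ : Submodule ℤ E} {x : E} (hx : x ∈ unitVectors Λ) :
    ⟪x, x⟫ = 1 := by
  rw [real_inner_self_eq_norm_sq, hx.2]; norm_num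

theorem mem_unitVectors_iff {Λ : Submodule ℤ E} {x : E} :
    x ∈ unitVectors Λ ↔ x ∈ Λ ∧ ⟪x, x⟫ = 1 := by
  refine ⟨fun h => ⟨h.1, inner_self_of_mem_unitVectors h⟩, fun h => ⟨h.1, ?_⟩⟩
  have := h.2
  rw [real_inner_self_eq_norm_sq] at this
  nlinarith [norm_nonneg x]

theorem minimalConfiguration_eq_unitVectors {Λ : Submodule ℤ E} (h1 : ∃ x ∈ Λ, ‖x‖ = 1)
    (h2 : ∀ x ∈ Λ, x ≠ 0 → 1 ≤ ⟪x, x⟫) : minimalConfiguration Λ = unitVectors Λ := by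
  obtain ⟨u, hu, hu1⟩ := h1
  have huu : ⟪u, u⟫ = 1 := by rw [real_inner_self_eq_norm_sq, hu1]; norm_num
  have hmin : minimalVectors Λ = unitVectors Λ := by
    ext x
    rw [mem_unitVectors_iff]
    constructor
    · rintro ⟨hx, hx0, hle⟩
      refine ⟨hx, le_antisymm ?_ (h2 x hx hx0)⟩
      rw [← huu]
      exact hle u hu (by rintro rfl; simp at hu1)
    · rintro ⟨hx, hx1⟩
      exact ⟨hx, by rintro rfl; simp at hx1, fun y hy hy0 => hx1 ▸ h2 y hy hy0⟩
  rw [minimalConfiguration, hmin]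
  ext x
  constructor
  · rintro ⟨y, hy, rfl⟩
    simpa [hy.2] using hy
  · intro hx
    exact ⟨x, hx, by simp [hx.2]⟩

theorem isConfiguration_unitVectors {E : Type*} [NormedAddCommGroup E] {Λ : Submodule ℤ E}
    (h : (unitVectors Λ).Finite) :
    IsConfiguration (unitVectors Λ) :=
  ⟨h, fun _ hx => hx.2, fun _ hx => ⟨neg_mem hx.1, by rw [norm_neg, hx.2]⟩⟩

theorem IsConfiguration.diff_pair {E : Type*} [NormedAddCommGroup E] {S : Set E}
    (hS : IsConfiguration S) (x : E) :
    IsConfiguration (S \ {x, -x}) where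
  finite := hS.finite.subset Set.sdiff_subset
  norm_eq_one y hy := hS.norm_eq_one y hy.1
  neg_mem y hy := ⟨hS.neg_mem y hy.1, fun h => hy.2 (by
    rcases h with h | h
    · exact Or.inr (by rw [Set.mem_singleton_iff, ← h, neg_neg])
    · exact Or.inl (neg_injective h))⟩

/-- All inner products between vectors of `Λ` lie in `½ℤ`. -/
def IsHalfIntegral (Λ : Submodule ℤ E) : Prop :=
  ∀ x ∈ Λ, ∀ y ∈ Λ, ∃ k : ℤ, 2 * ⟪x, y⟫ = k

theorem IsHalfIntegral.reflection_mem {Λ : Submodule ℤ E} (hΛ : IsHalfIntegral Λ) {x y : E}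
    (hx : x ∈ unitVectors Λ) (hy : y ∈ Λ) : y - (2 * ⟪y, x⟫) • x ∈ Λ := by
  obtain ⟨k, hk⟩ := hΛ y hy x hx.1
  rw [hk, Int.cast_smul_eq_zsmul]
  exact sub_mem hy (Λ.smul_mem k hx.1)

theorem IsHalfIntegral.reflection_mem_unitVectors {Λ : Submodule ℤ E} (hΛ : IsHalfIntegral Λ)
    {x y : E} (hx : x ∈ unitVectors Λ) (hy : y ∈ unitVectors Λ) :
    y - (2 * ⟪y, x⟫) • x ∈ unitVectors Λ := by
  rw [mem_unitVectors_iff]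
  refine ⟨hΛ.reflection_mem hx hy.1, ?_⟩
  simp only [inner_sub_left, inner_sub_right, real_inner_smul_left, real_inner_smul_right,
    inner_self_of_mem_unitVectors hx, inner_self_of_mem_unitVectors hy, real_inner_comm x y]
  ring

theorem exists_id_eq_smul_sum_unitVectors [Nontrivial E] {Λ : Submodule ℤ E}
    (hp : IsPerfect (unitVectors Λ)) (hΛ : IsHalfIntegral Λ) :
    ∃ c : ℝ, 0 < c ∧ LinearMap.id = c • ∑ x ∈ hp.1.finite.toFinset, proj x :=
  exists_id_eq_smul_sum hp fun _ hx _ hy => hΛ.reflection_mem_unitVectors hx hy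

theorem isExtreme_unitVectors [Nontrivial E] {Λ : Submodule ℤ E}
    (hp : IsPerfect (unitVectors Λ)) (hΛ : IsHalfIntegral Λ) : IsExtreme (unitVectors Λ) := by
  obtain ⟨c, hc, hid⟩ := exists_id_eq_smul_sum_unitVectors hp hΛ
  refine ⟨hp, hp.1, fun _ => c, ⟨fun _ _ => rfl, ?_⟩, fun _ _ => hc⟩
  rw [finsum_mem_smul_proj hp.1.finite, ← Finset.smul_sum]
  exact hid

theorem halfFrame_mem {Λ : Submodule ℤ E} {f : Fin 4 → E} (hf : Orthonormal ℝ f)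
    (hfΛ : ∀ i, f i ∈ Λ) (hsum : (1 / 2 : ℝ) • (f 0 + f 1 + f 2 + f 3) ∈ Λ) (i : Fin 4) :
    halfFrame f i ∈ unitVectors Λ \ {f 0, -f 0} := by
  have hin := orthonormal_iff_ite.1 hf
  have hΛ : halfFrame f i ∈ Λ := by
    fin_cases i
    · exact hsum
    · convert sub_mem (sub_mem hsum (hfΛ 2)) (hfΛ 3) using 1
      simp [halfFrame]; module
    · convert sub_mem (sub_mem hsum (hfΛ 1)) (hfΛ 3) using 1
      simp [halfFrame]; module
    · convert sub_mem (sub_mem hsum (hfΛ 1)) (hfΛ 2) using 1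
      simp [halfFrame]; module
  have h1 : ⟪halfFrame f i, halfFrame f i⟫ = 1 := by
    fin_cases i <;>
      simp [halfFrame, inner_add_left, inner_add_right, inner_sub_left, inner_sub_right,
        real_inner_smul_left, real_inner_smul_right, hin, -inner_self_eq_norm_sq_to_K] <;> norm_num
  -- Inner product `1/2` with `f 0` shows that the new vectors are not `±f 0`, so they survive its
  -- removal.
  have h2 : ⟪halfFrame f i, f 0⟫ = 1 / 2 := by
    fin_cases i <;>
      simp [halfFrame, inner_add_left, inner_sub_left, real_inner_smul_left, hin,
        -inner_self_eq_norm_sq_to_K]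
  have h00 : ⟪f 0, f 0⟫ = 1 := by simpa using hin 0 0
  refine ⟨mem_unitVectors_iff.2 ⟨hΛ, h1⟩, ?_⟩
  rintro (h | h) <;> rw [h] at h2
  · linarith
  · rw [inner_neg_left] at h2; linarith

/-- Two orthonormal quadruples of vectors of `Λ₀` that share, up to sign, only their first vector
`x`, each of which has its half-sum in `Λ`. -/
def HasFramePair (Λ₀ Λ : Submodule ℤ E) (x : E) : Prop :=
  ∃ f f' : Fin 4 → E, Orthonormal ℝ f ∧ Orthonormal ℝ f' ∧ f 0 = x ∧ f' 0 = x ∧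
    (∀ i, f i ∈ Λ₀) ∧ (∀ i, f' i ∈ Λ₀) ∧ (1 / 2 : ℝ) • (f 0 + f 1 + f 2 + f 3) ∈ Λ ∧
    (1 / 2 : ℝ) • (f' 0 + f' 1 + f' 2 + f' 3) ∈ Λ ∧
    ∀ i j, i ≠ 0 → j ≠ 0 → f i ≠ f' j ∧ f i ≠ -f' j

theorem HasFramePair.isExtreme_diff [Nontrivial E] {Λ₀ Λ : Submodule ℤ E} {x : E}
    (h : HasFramePair Λ₀ Λ x) (hle : Λ₀ ≤ Λ) (hp : IsPerfect (unitVectors Λ₀))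
    (hΛ₀ : IsHalfIntegral Λ₀) (hfin : (unitVectors Λ).Finite) :
    IsExtreme (unitVectors Λ \ {x, -x}) := by
  obtain ⟨c, hc, hid⟩ := exists_id_eq_smul_sum_unitVectors hp hΛ₀
  obtain ⟨f, f', hf, hf', rfl, h0, hm, hm', hs, hs', hne⟩ := h
  refine isExtreme_of_frames hp ((isConfiguration_unitVectors hfin).diff_pair _) hc hid hf hf' h0
    (fun i => ⟨hm i, hf.1 i⟩) (fun i => ⟨hm' i, hf'.1 i⟩)
    (halfFrame_mem hf (fun i => hle (hm i)) hs) ?_ ?_ hne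
  · rw [← h0]
    exact halfFrame_mem hf' (fun i => hle (hm' i)) hs'
  · intro y hy h1 h2
    exact ⟨⟨hle hy.1, hy.2⟩, by rintro (h | h); exacts [h1 h, h2 h]⟩

theorem HasFramePair.map {Λ₀ Λ : Submodule ℤ E} {x : E} (h : HasFramePair Λ₀ Λ x)
    (g : E →ₗᵢ[ℝ] E) (h₀ : ∀ y ∈ Λ₀, g y ∈ Λ₀) (hg : ∀ y ∈ Λ, g y ∈ Λ) :
    HasFramePair Λ₀ Λ (g x) := by
  obtain ⟨f, f', hf, hf', h1, h2, hm, hm', hs, hs', hne⟩ := h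
  refine ⟨g ∘ f, g ∘ f', hf.comp_linearIsometry g, hf'.comp_linearIsometry g,
    by simp [h1], by simp [h2], fun i => h₀ _ (hm i), fun i => h₀ _ (hm' i), ?_, ?_,
    fun i j hi hj => ?_⟩
  · simpa using hg _ hs
  · simpa using hg _ hs'
  · obtain ⟨h3, h4⟩ := hne i j hi hj
    exact ⟨fun h => h3 (g.injective h), fun h => h4 (g.injective (by simpa using h))⟩

/-- Frame pairs are transported between non-orthogonal roots. -/
theorem HasFramePair.of_inner_ne_zero {Λ : Submodule ℤ E} (hΛ : IsHalfIntegral Λ) {x y : E}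
    (hx : x ∈ unitVectors Λ) (hy : y ∈ unitVectors Λ) (hxy : ⟪x, y⟫ ≠ 0)
    (h : HasFramePair Λ Λ x) : HasFramePair Λ Λ y := by
  have hneg : ∀ z, HasFramePair Λ Λ z → HasFramePair Λ Λ (-z) := fun z hz => by
    simpa using hz.map (LinearIsometryEquiv.neg ℝ).toLinearIsometry
      (fun y hy => by simpa using hy) (fun y hy => by simpa using hy)
  -- At inner product `1/2` the difference `x - y` is itself a root, and its reflection maps `x` to
  -- `y` while preserving `Λ`.
  have key : ∀ y ∈ unitVectors Λ, ⟪x, y⟫ = 1 / 2 → HasFramePair Λ Λ y := by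
    intro y hy hxy
    have hd : x - y ∈ unitVectors Λ := by
      rw [mem_unitVectors_iff]
      refine ⟨sub_mem hx.1 hy.1, ?_⟩
      rw [real_inner_sub_sub_self, inner_self_of_mem_unitVectors hx,
        inner_self_of_mem_unitVectors hy, hxy]
      norm_num
    have hmap : ∀ z, (ℝ ∙ (x - y))ᗮ.reflection z = z - (2 * ⟪z, x - y⟫) • (x - y) := fun z => by
      rw [Submodule.reflection_orthogonal, LinearIsometryEquiv.trans_apply,
        Submodule.reflection_singleton_apply]
      simp [hd.2, real_inner_comm (x - y) z]
      module
    have := h.map (ℝ ∙ (x - y))ᗮ.reflection.toLinearIsometry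
      (fun z hz => by simpa [hmap] using hΛ.reflection_mem hd hz)
      (fun z hz => by simpa [hmap] using hΛ.reflection_mem hd hz)
    rwa [LinearIsometryEquiv.coe_toLinearIsometry, Submodule.reflection_sub (hx.2.trans hy.2.symm)]
      at this
  obtain ⟨k, hk⟩ := hΛ x hx.1 y hy.1
  have habs : |⟪x, y⟫| ≤ 1 := by
    simpa [hx.2, hy.2] using abs_real_inner_le_norm x y
  have hk2 : |(k : ℝ)| ≤ 2 := by rw [← hk, abs_mul, abs_two]; linarith
  have hk3 : |k| ≤ 2 := by exact_mod_cast hk2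
  have hk4 : k ≠ 0 := by rintro rfl; simp at hk; exact hxy hk
  obtain ⟨h5, h6⟩ := abs_le.1 hk3
  -- By half-integrality and Cauchy–Schwarz, the nonzero `k = 2⟪x, y⟫` is `±1` or `±2`. The values
  -- `±2` mean `y = ±x`, and `-1` reduces to `1` by a sign change.
  interval_cases k
  · have : x = -y := (inner_eq_one_iff_of_norm_eq_one (𝕜 := ℝ) hx.2 (by rw [norm_neg, hy.2])).1 (by
      rw [inner_neg_right]; push_cast at hk; linarith)
    rw [← neg_eq_iff_eq_neg] at this
    exact this ▸ hneg x h
  · rw [← neg_neg y]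
    refine hneg _ (key (-y) ⟨neg_mem hy.1, by rw [norm_neg, hy.2]⟩ ?_)
    rw [inner_neg_right]; push_cast at hk; linarith
  · exact absurd rfl hk4
  · exact key y hy (by push_cast at hk; linarith)
  · have : x = y := (inner_eq_one_iff_of_norm_eq_one (𝕜 := ℝ) hx.2 hy.2).1 (by
      push_cast at hk; linarith)
    exact this ▸ h

end Lattices

/-! ### Lattices determined by a Cartan matrix. -/

section RootLattices

variable {E : Type*} [NormedAddCommGroup E] [InnerProductSpace ℝ E]

theorem isHalfIntegral_span {ι : Type*} {a : ι → E} {C : Matrix ι ι ℤ}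
    (h : ∀ i j, ⟪a i, a j⟫ = (C i j : ℝ) / 2) :
    IsHalfIntegral (Submodule.span ℤ (Set.range a)) := by
  intro x hx y hy
  induction hx, hy using Submodule.span_induction₂ with
  | mem_mem x y hx hy =>
    obtain ⟨i, rfl⟩ := hx
    obtain ⟨j, rfl⟩ := hy
    exact ⟨C i j, by rw [h]; ring⟩
  | zero_left => exact ⟨0, by simp⟩
  | zero_right => exact ⟨0, by simp⟩
  | add_left x y z _ _ _ hx hy =>
    obtain ⟨k, hk⟩ := hx
    obtain ⟨l, hl⟩ := hy
    exact ⟨k + l, by rw [inner_add_left]; push_cast; linarith⟩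
  | add_right x y z _ _ _ hx hy =>
    obtain ⟨k, hk⟩ := hx
    obtain ⟨l, hl⟩ := hy
    exact ⟨k + l, by rw [inner_add_right]; push_cast; linarith⟩
  | smul_left r x y _ _ hx =>
    obtain ⟨k, hk⟩ := hx
    refine ⟨r * k, ?_⟩
    rw [← Int.cast_smul_eq_zsmul ℝ, real_inner_smul_left]; push_cast; rw [← hk]; ring
  | smul_right r x y _ _ hx =>
    obtain ⟨k, hk⟩ := hx
    refine ⟨r * k, ?_⟩
    rw [← Int.cast_smul_eq_zsmul ℝ, real_inner_smul_right]; push_cast; rw [← hk]; ring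

/-- The lattice is even after doubling the form: cross terms contribute `2⟪x, y⟫ ∈ ℤ`. Hence nonzero
vectors have squared norm at least one and the simple roots are minimal. -/
theorem exists_inner_self_eq_int {ι : Type*} {a : ι → E} {C : Matrix ι ι ℤ}
    (h : ∀ i j, ⟪a i, a j⟫ = (C i j : ℝ) / 2) (hC : ∀ i, C i i = 2) {x : E}
    (hx : x ∈ Submodule.span ℤ (Set.range a)) : ∃ k : ℤ, ⟪x, x⟫ = k := by
  induction hx using Submodule.span_induction with
  | mem x hx => obtain ⟨i, rfl⟩ := hx; exact ⟨1, by rw [h, hC]; norm_num⟩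
  | zero => exact ⟨0, by simp⟩
  | add x y hx hy h1 h2 =>
    obtain ⟨k, hk⟩ := h1
    obtain ⟨l, hl⟩ := h2
    obtain ⟨m, hm⟩ := isHalfIntegral_span h x hx y hy
    exact ⟨k + m + l, by rw [real_inner_add_add_self]; push_cast; linarith⟩
  | smul r x _ hx =>
    obtain ⟨k, hk⟩ := hx
    refine ⟨r ^ 2 * k, ?_⟩
    rw [← Int.cast_smul_eq_zsmul ℝ, real_inner_smul_right, real_inner_smul_left, hk]
    push_cast; ring

theorem mem_unitVectors_of_diag {ι : Type*} {a : ι → E} {C : Matrix ι ι ℤ}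
    (h : ∀ i j, ⟪a i, a j⟫ = (C i j : ℝ) / 2) (hC : ∀ i, C i i = 2) (i : ι) :
    a i ∈ unitVectors (Submodule.span ℤ (Set.range a)) :=
  mem_unitVectors_iff.2 ⟨Submodule.subset_span ⟨i, rfl⟩, by rw [h, hC]; norm_num⟩

theorem minimalConfiguration_span_eq {ι : Type*} [Nonempty ι] {a : ι → E} {C : Matrix ι ι ℤ}
    (h : ∀ i j, ⟪a i, a j⟫ = (C i j : ℝ) / 2) (hC : ∀ i, C i i = 2) :
    minimalConfiguration (Submodule.span ℤ (Set.range a)) =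
      unitVectors (Submodule.span ℤ (Set.range a)) := by
  obtain ⟨i⟩ := ‹Nonempty ι›
  refine minimalConfiguration_eq_unitVectors ⟨a i, mem_unitVectors_of_diag h hC i⟩ ?_
  intro x hx hx0
  obtain ⟨k, hk⟩ := exists_inner_self_eq_int h hC hx
  have hpos : 0 < ⟪x, x⟫ := real_inner_self_pos.2 hx0
  rw [hk] at hpos ⊢
  have : 0 < k := by exact_mod_cast hpos
  exact_mod_cast this

theorem finite_unitVectors_span {ι : Type*} [Finite ι] (b : Module.Basis ι ℝ E) :
    (unitVectors (Submodule.span ℤ (Set.range b))).Finite := by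
  have : FiniteDimensional ℝ E := b.finiteDimensional_of_finite
  refine (ZSpan.setFinite_inter b (Metric.isBounded_closedBall (x := (0 : E)) (r := 1))).subset ?_
  rintro x ⟨hx, hx1⟩
  exact ⟨by simp [hx1], hx⟩

/-- Linear independence of a family depends only on its Gram matrix. -/
theorem linearIndependent_of_gram {ι F : Type*} [Fintype ι] [NormedAddCommGroup F]
    [InnerProductSpace ℝ F] {b : ι → E} {a : ι → F} (hb : LinearIndependent ℝ b)
    (h : ∀ i j, ⟪a i, a j⟫ = ⟪b i, b j⟫) : LinearIndependent ℝ a := by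
  rw [Fintype.linearIndependent_iff] at hb ⊢
  intro c hc
  apply hb c
  rw [← inner_self_eq_zero (𝕜 := ℝ)] at hc ⊢
  rw [← hc]
  simp only [sum_inner, inner_sum, real_inner_smul_left, real_inner_smul_right, h]

theorem exists_linearIsometryEquiv {ι F : Type*} [Fintype ι] [NormedAddCommGroup F]
    [InnerProductSpace ℝ F] (b : Module.Basis ι ℝ E) (a : Module.Basis ι ℝ F)
    (h : ∀ i j, ⟪a i, a j⟫ = ⟪b i, b j⟫) : ∃ g : E ≃ₗᵢ[ℝ] F, ∀ i, g (b i) = a i := by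
  refine ⟨(b.equiv a (Equiv.refl ι)).isometryOfInner fun x y => ?_, fun i => by simp⟩
  rw [← b.sum_repr x, ← b.sum_repr y]
  simp only [map_sum, map_smul, Module.Basis.equiv_apply, Equiv.refl_apply, sum_inner, inner_sum,
    real_inner_smul_left, real_inner_smul_right, h]

theorem exists_basis_coe_eq {n : ℕ} {a : Fin n → EuclideanSpace ℝ (Fin n)}
    (ha : LinearIndependent ℝ a) :
    ∃ b : Module.Basis (Fin n) ℝ (EuclideanSpace ℝ (Fin n)), ⇑b = a := by
  rcases Nat.eq_zero_or_pos n with rfl | hn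
  · exact ⟨Module.Basis.empty _, Subsingleton.elim _ _⟩
  · have : Nonempty (Fin n) := ⟨⟨0, hn⟩⟩
    exact ⟨basisOfLinearIndependentOfCardEqFinrank ha (by simp), by simp⟩

end RootLattices

/-! ### Root lattices in integer coordinates, and `E₆`, `E₇`, `E₈`. -/

section Exceptional

variable {E : Type*} [NormedAddCommGroup E] [InnerProductSpace ℝ E]

-- The rows of the symmetric square root of `G` realise `G` as a Gram matrix.
open scoped MatrixOrder in
theorem exists_gram_eq {n : ℕ} {G : Matrix (Fin n) (Fin n) ℝ} (hG : G.PosSemidef) :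
    ∃ a : Fin n → EuclideanSpace ℝ (Fin n), ∀ i j, ⟪a i, a j⟫ = G i j := by
  have h1 : CFC.sqrt G * CFC.sqrt G = G := CFC.sqrt_mul_sqrt_self G hG.nonneg
  have h2 : (CFC.sqrt G).IsHermitian :=
    (Matrix.nonneg_iff_posSemidef.1 (CFC.sqrt_nonneg G)).isHermitian
  refine ⟨fun i => WithLp.toLp 2 fun k => CFC.sqrt G i k, fun i j => ?_⟩
  have h3 : ∀ k, CFC.sqrt G k j = CFC.sqrt G j k := fun k => by simpa using h2.apply j k
  conv_rhs => rw [← h1, Matrix.mul_apply]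
  rw [PiLp.inner_apply]
  exact Finset.sum_congr rfl fun k _ => by rw [h3]; simp [mul_comm]

theorem exists_isRootLattice_of_posDef {n : ℕ} {C : Matrix (Fin n) (Fin n) ℤ} (hC : C.IsSymm)
    (hpos : ∀ c : Fin n → ℝ, 0 ≤ ∑ i, ∑ j, c i * c j * (C i j : ℝ)) :
    ∃ Λ, IsRootLattice C Λ := by
  obtain ⟨a, ha⟩ := exists_gram_eq (G := Matrix.of fun i j => (C i j : ℝ) / 2) (by
    refine .of_dotProduct_mulVec_nonneg ?_ fun c => ?_
    · ext i j
      simp [hC.apply i j]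
    · have := hpos c
      simp only [dotProduct, Matrix.mulVec, Matrix.of_apply, Pi.star_apply, star_trivial,
        Finset.mul_sum]
      calc (0 : ℝ) ≤ 1 / 2 * ∑ i, ∑ j, c i * c j * (C i j : ℝ) := by positivity
        _ = _ := by
          simp only [Finset.mul_sum]
          exact Finset.sum_congr rfl fun i _ => Finset.sum_congr rfl fun j _ => by ring)
  exact ⟨_, a, ha, rfl⟩

theorem linearIndependent_of_gram_definite {ι : Type*} [Fintype ι] {a : ι → E}
    {C : Matrix ι ι ℤ} (h : ∀ i j, ⟪a i, a j⟫ = (C i j : ℝ) / 2)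
    (hdef : ∀ c : ι → ℝ, ∑ i, ∑ j, c i * c j * (C i j : ℝ) = 0 → c = 0) :
    LinearIndependent ℝ a := by
  rw [Fintype.linearIndependent_iff]
  intro c hc i
  refine congrFun (hdef c ?_) i
  rw [← inner_self_eq_zero (𝕜 := ℝ)] at hc
  simp only [sum_inner, inner_sum, real_inner_smul_left, real_inner_smul_right, h] at hc
  calc ∑ i, ∑ j, c i * c j * (C i j : ℝ) = 2 * ∑ i, ∑ j, c i * (c j * ((C j i : ℝ) / 2)) := by
        rw [Finset.sum_comm]
        simp only [Finset.mul_sum]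
        exact Finset.sum_congr rfl fun i _ => Finset.sum_congr rfl fun j _ => by ring
    _ = 0 := by rw [hc, mul_zero]

/-- The lattice vector with coordinates `z` in terms of the simple roots `a`. -/
def rootComb {ι : Type*} [Fintype ι] (a : ι → E) (z : ι → ℤ) : E := ∑ i, z i • a i

section RootComb

variable {ι : Type*} [Fintype ι] {a : ι → E} {C : Matrix ι ι ℤ}

omit [InnerProductSpace ℝ E] in
theorem rootComb_mem (z : ι → ℤ) : rootComb a z ∈ Submodule.span ℤ (Set.range a) :=
  Submodule.sum_mem _ fun i _ => Submodule.smul_mem _ _ (Submodule.subset_span ⟨i, rfl⟩)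

omit [InnerProductSpace ℝ E] in
theorem rootComb_add (z w : ι → ℤ) : rootComb a (z + w) = rootComb a z + rootComb a w := by
  simp [rootComb, add_smul, Finset.sum_add_distrib]

omit [InnerProductSpace ℝ E] in
theorem rootComb_single [DecidableEq ι] (i : ι) : rootComb a (Pi.single i 1) = a i := by
  simp [rootComb, Pi.single_apply, ite_smul]

theorem inner_rootComb (h : ∀ i j, ⟪a i, a j⟫ = (C i j : ℝ) / 2) (z w : ι → ℤ) :
    ⟪rootComb a z, rootComb a w⟫ = ((∑ i, ∑ j, z i * C i j * w j : ℤ) : ℝ) / 2 := by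
  simp only [rootComb, sum_inner, inner_sum, ← Int.cast_smul_eq_zsmul ℝ, real_inner_smul_left,
    real_inner_smul_right, h]
  push_cast
  rw [Finset.sum_div, Finset.sum_comm]
  refine Finset.sum_congr rfl fun i _ => ?_
  rw [Finset.sum_div]
  exact Finset.sum_congr rfl fun j _ => by ring

theorem rootComb_mem_unitVectors (h : ∀ i j, ⟪a i, a j⟫ = (C i j : ℝ) / 2) {z : ι → ℤ}
    (hz : ∑ i, ∑ j, z i * C i j * z j = 2) :
    rootComb a z ∈ unitVectors (Submodule.span ℤ (Set.range a)) :=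
  mem_unitVectors_iff.2 ⟨rootComb_mem z, by rw [inner_rootComb h, hz]; norm_num⟩

theorem orthonormal_rootComb (h : ∀ i j, ⟪a i, a j⟫ = (C i j : ℝ) / 2) {κ : Type*}
    [DecidableEq κ] {F : κ → ι → ℤ}
    (hF : ∀ k l, ∑ i, ∑ j, F k i * C i j * F l j = if k = l then 2 else 0) :
    Orthonormal ℝ fun k => rootComb a (F k) := by
  rw [orthonormal_iff_ite]
  intro k l
  rw [inner_rootComb h, hF]
  split_ifs <;> norm_num

/-- Turns the existence of a frame pair into finitely many integer identities; `s` and `s'` are the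
coordinates of the two half-sums. -/
theorem hasFramePair_rootComb (h : ∀ i j, ⟪a i, a j⟫ = (C i j : ℝ) / 2)
    (ha : LinearIndependent ℝ a) {F F' : Fin 4 → ι → ℤ} {s s' : ι → ℤ}
    (hF : ∀ k l, ∑ i, ∑ j, F k i * C i j * F l j = if k = l then 2 else 0)
    (hF' : ∀ k l, ∑ i, ∑ j, F' k i * C i j * F' l j = if k = l then 2 else 0)
    (h0 : F' 0 = F 0) (hs : F 0 + F 1 + F 2 + F 3 = s + s)
    (hs' : F' 0 + F' 1 + F' 2 + F' 3 = s' + s')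
    (hne : ∀ i j, i ≠ 0 → j ≠ 0 → F i ≠ F' j ∧ F i + F' j ≠ 0) :
    HasFramePair (Submodule.span ℤ (Set.range a)) (Submodule.span ℤ (Set.range a))
      (rootComb a (F 0)) := by
  have hinj : ∀ z : ι → ℤ, rootComb a z = 0 → z = 0 := fun z hz => by
    simp only [rootComb, ← Int.cast_smul_eq_zsmul ℝ] at hz
    funext i
    exact_mod_cast Fintype.linearIndependent_iff.1 ha _ hz i
  have hhalf : ∀ G : Fin 4 → ι → ℤ, ∀ t : ι → ℤ, G 0 + G 1 + G 2 + G 3 = t + t →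
      (1 / 2 : ℝ) • (rootComb a (G 0) + rootComb a (G 1) + rootComb a (G 2) + rootComb a (G 3)) ∈
        Submodule.span ℤ (Set.range a) := fun G t ht => by
    rw [← rootComb_add, ← rootComb_add, ← rootComb_add, ht, rootComb_add]
    convert rootComb_mem (a := a) t using 1
    module
  refine ⟨fun k => rootComb a (F k), fun k => rootComb a (F' k), orthonormal_rootComb h hF,
    orthonormal_rootComb h hF', rfl, congrArg _ h0, fun k => rootComb_mem _,
    fun k => rootComb_mem _,
    hhalf F s hs, hhalf F' s' hs', fun i j hi hj => ?_⟩
  obtain ⟨h1, h2⟩ := hne i j hi hj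
  beta_reduce
  refine ⟨fun h => h1 (sub_eq_zero.1 (hinj _ ?_)), fun h => h2 (hinj _ ?_)⟩
  · have h3 : rootComb a (F i - F' j) + rootComb a (F' j) = rootComb a (F i) := by
      rw [← rootComb_add, sub_add_cancel]
    rw [h] at h3
    exact add_eq_right.1 h3
  · rw [rootComb_add, h, neg_add_cancel]

end RootComb

/-- Twice the norm of the lattice vector with coordinates `u`. -/
def cartanForm {ι : Type*} [Fintype ι] (C : Matrix ι ι ℤ) (u : ι → ℤ) : ℤ :=
  ∑ k, ∑ l, u k * C k l * u l

/-- The vectors `t`, `aᵢ + t`, `t + aⱼ` and `aᵢ + t + aⱼ` are roots. -/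
def IsRootChain {n : ℕ} (C : Matrix (Fin n) (Fin n) ℤ) (i : Fin n) (t : Fin n → ℤ)
    (j : Fin n) : Prop :=
  cartanForm C t = 2 ∧ cartanForm C (Pi.single i 1 + t) = 2 ∧
    cartanForm C (t + Pi.single j 1) = 2 ∧ cartanForm C (Pi.single i 1 + t + Pi.single j 1) = 2

instance {n : ℕ} (C : Matrix (Fin n) (Fin n) ℤ) (i : Fin n) (t : Fin n → ℤ) (j : Fin n) :
    Decidable (IsRootChain C i t j) :=
  inferInstanceAs (Decidable (_ ∧ _ ∧ _ ∧ _))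

/-- A connected simply laced root lattice in which any two orthogonal simple roots are the ends of
a chain of roots, and with a frame pair at one simple root, is redundantly extreme. -/
theorem isRedundantlyExtreme_of_framePair {n : ℕ} [NeZero n] {C : Matrix (Fin n) (Fin n) ℤ}
    (hdiag : ∀ i, C i i = 2)
    (hdef : ∀ c : Fin n → ℝ, ∑ i, ∑ j, c i * c j * (C i j : ℝ) = 0 → c = 0)
    (hperf : ∀ i j, i = j ∨ cartanForm C (Pi.single i 1 + Pi.single j 1) = 2 ∨
      ∃ t, IsRootChain C i t j)
    (hconn : ∀ P : Fin n → Prop, P 0 → (∀ i j, C i j ≠ 0 → P i → P j) → ∀ i, P i)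
    {F F' : Fin 4 → Fin n → ℤ} {s s' : Fin n → ℤ}
    (hF : ∀ k l, ∑ i, ∑ j, F k i * C i j * F l j = if k = l then 2 else 0)
    (hF' : ∀ k l, ∑ i, ∑ j, F' k i * C i j * F' l j = if k = l then 2 else 0)
    (hF0 : F 0 = Pi.single 0 1) (h0 : F' 0 = F 0) (hs : F 0 + F 1 + F 2 + F 3 = s + s)
    (hs' : F' 0 + F' 1 + F' 2 + F' 3 = s' + s')
    (hne : ∀ i j, i ≠ 0 → j ≠ 0 → F i ≠ F' j ∧ F i + F' j ≠ 0)
    {Λ : Submodule ℤ (EuclideanSpace ℝ (Fin n))} (hΛ : IsRootLattice C Λ) :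
    IsRedundantlyExtreme (minimalConfiguration Λ) := by
  obtain ⟨a, ha, rfl⟩ := hΛ
  have hli := linearIndependent_of_gram_definite ha hdef
  obtain ⟨b, rfl⟩ := exists_basis_coe_eq hli
  rw [minimalConfiguration_span_eq ha hdiag]
  have hfin := finite_unitVectors_span b
  have hhalf := isHalfIntegral_span ha
  have hroot := mem_unitVectors_of_diag ha hdiag
  have hp : IsPerfect (unitVectors (Submodule.span ℤ (Set.range b))) := by
    refine isPerfect_of_symmProd_mem (isConfiguration_unitVectors hfin) b.span_eq fun i j => ?_
    rcases hperf i j with rfl | hij | ⟨t, ht⟩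
    · rw [symmProd_self]
      exact Submodule.smul_mem _ _ (proj_mem_span (hroot i))
    · have := rootComb_mem_unitVectors ha hij
      rw [rootComb_add, rootComb_single, rootComb_single] at this
      exact symmProd_mem_span_of_add_mem (hroot i) (hroot j) this
    · refine symmProd_mem_span_of_chain (t := rootComb b t)
        (rootComb_mem_unitVectors ha ht.1) ?_ ?_ ?_
      · have := rootComb_mem_unitVectors ha ht.2.1
        rwa [rootComb_add, rootComb_single] at this
      · have := rootComb_mem_unitVectors ha ht.2.2.1
        rwa [rootComb_add, rootComb_single] at this
      · have := rootComb_mem_unitVectors ha ht.2.2.2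
        rwa [rootComb_add, rootComb_add, rootComb_single, rootComb_single] at this
  -- The given pair sits at node `0`; edges of the connected diagram carry it to every simple root.
  have hpair : ∀ i, HasFramePair (Submodule.span ℤ (Set.range b))
      (Submodule.span ℤ (Set.range b)) (b i) := by
    refine hconn _ ?_ ?_
    · have := hasFramePair_rootComb ha hli hF hF' h0 hs hs' hne
      rwa [hF0, rootComb_single] at this
    · intro i j hij
      refine HasFramePair.of_inner_ne_zero hhalf (hroot i) (hroot j) ?_
      rw [ha]
      exact div_ne_zero (by exact_mod_cast hij) two_ne_zero
  refine ⟨isExtreme_unitVectors hp hhalf, fun x hx => ?_⟩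
  -- A nonzero root is not orthogonal to all simple roots, so one further transport reaches it.
  obtain ⟨i, hi⟩ : ∃ i, ⟪b i, x⟫ ≠ 0 := by
    by_contra! hall
    have : x = 0 := InnerProductSpace.ext_inner_left_basis (𝕜 := ℝ) b fun i => by simpa using hall i
    simpa [this] using hx.2
  exact (HasFramePair.of_inner_ne_zero hhalf (hroot i) hx hi (hpair i)).isExtreme_diff le_rfl hp
    hhalf hfin

/-- The vector with the given coordinates, padded by zeros. -/
def padded (n : ℕ) (l : List ℤ) : Fin n → ℤ := fun k => l.getD k 0

/-- The first of two frames at the first simple root of `E₆`, `E₇` and `E₈`. -/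
def frameE (n : ℕ) : Fin 4 → Fin n → ℤ :=
  -- The coordinates involve only the first six nodes, so the same roots serve in all three
  -- diagrams.
  ![padded n [1], padded n [0, 0, 0, 0, 1, 1], padded n [0, 1], padded n [1, 1, 2, 2, 1, 1]]

/-- The second of the two frames at the first simple root. -/
def frameE' (n : ℕ) : Fin 4 → Fin n → ℤ :=
  ![padded n [1], padded n [0, 1, 0, 1, 1], padded n [0, 0, 0, 1], padded n [1, 1, 2, 2, 1]]

/-- The sum of the simple roots strictly between the nodes `i` and `j` of the diagram of type
`E₆`, `E₇` or `E₈`. -/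
def pathInterior {n : ℕ} (i j : Fin n) : Fin n → ℤ :=
  let p : ℕ := min i j
  let q : ℕ := max i j
  -- The diagram is the path `0 - 2 - 3 - 4 - ⋯` with node `1` attached to `3`. The path from `0`
  -- continues at `2`, and from `1` at `3`; the bounds correct for this numbering. The values at
  -- equal or adjacent nodes are not used.
  fun k => if (if p = 0 then 2 else max 3 (p + 1)) ≤ k.val ∧
    k.val ≤ (if q = 3 then 2 else max 3 (q - 1)) then 1 else 0

/-- Squares are completed along the three arms towards the branch node `3`. An arm of `k` nodes uses
up `k/(k+1)` of the coefficient `2` there, leaving `2 - 1/2 - 2/3 - 2/3 = 1/6`. For `E₇` and `E₈`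
the last arm takes `3/4` and `4/5`, leaving `1/12` and `1/30`. -/
theorem E₆_form (c : Fin 6 → ℝ) : ∑ i, ∑ j, c i * c j * (CartanMatrix.E₆ i j : ℝ) =
    2 * (c 0 - c 2 / 2) ^ 2 + 3 / 2 * (c 2 - 2 / 3 * c 3) ^ 2 + 2 * (c 1 - c 3 / 2) ^ 2 +
    2 * (c 5 - c 4 / 2) ^ 2 + 3 / 2 * (c 4 - 2 / 3 * c 3) ^ 2 + 1 / 6 * c 3 ^ 2 := by
  simp [Fin.sum_univ_succ, CartanMatrix.E₆]
  ring

theorem E₇_form (c : Fin 7 → ℝ) : ∑ i, ∑ j, c i * c j * (CartanMatrix.E₇ i j : ℝ) =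
    2 * (c 0 - c 2 / 2) ^ 2 + 3 / 2 * (c 2 - 2 / 3 * c 3) ^ 2 + 2 * (c 1 - c 3 / 2) ^ 2 +
    2 * (c 6 - c 5 / 2) ^ 2 + 3 / 2 * (c 5 - 2 / 3 * c 4) ^ 2 +
    4 / 3 * (c 4 - 3 / 4 * c 3) ^ 2 + 1 / 12 * c 3 ^ 2 := by
  simp [Fin.sum_univ_succ, CartanMatrix.E₇]
  ring

theorem E₈_form (c : Fin 8 → ℝ) : ∑ i, ∑ j, c i * c j * (CartanMatrix.E₈ i j : ℝ) =
    2 * (c 0 - c 2 / 2) ^ 2 + 3 / 2 * (c 2 - 2 / 3 * c 3) ^ 2 + 2 * (c 1 - c 3 / 2) ^ 2 +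
    2 * (c 7 - c 6 / 2) ^ 2 + 3 / 2 * (c 6 - 2 / 3 * c 5) ^ 2 +
    4 / 3 * (c 5 - 3 / 4 * c 4) ^ 2 + 5 / 4 * (c 4 - 4 / 5 * c 3) ^ 2 + 1 / 30 * c 3 ^ 2 := by
  simp [Fin.sum_univ_succ, CartanMatrix.E₈]
  ring

theorem exists_isRootLattice_E₆ : ∃ Λ, IsRootLattice CartanMatrix.E₆ Λ :=
  exists_isRootLattice_of_posDef CartanMatrix.E₆_isSymm fun c => by rw [E₆_form]; positivity

theorem exists_isRootLattice_E₇ : ∃ Λ, IsRootLattice CartanMatrix.E₇ Λ :=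
  exists_isRootLattice_of_posDef CartanMatrix.E₇_isSymm fun c => by rw [E₇_form]; positivity

theorem exists_isRootLattice_E₈ : ∃ Λ, IsRootLattice CartanMatrix.E₈ Λ :=
  exists_isRootLattice_of_posDef CartanMatrix.E₈_isSymm fun c => by rw [E₈_form]; positivity

theorem eq_zero_of_E₆_form {c : Fin 6 → ℝ}
    (h : ∑ i, ∑ j, c i * c j * (CartanMatrix.E₆ i j : ℝ) = 0) : c = 0 := by
  rw [E₆_form] at h
  have key : ∀ {a x : ℝ}, a ≠ 0 → a * x ^ 2 = 0 → x = 0 := fun ha hx => by simpa [ha] using hx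
  obtain ⟨h, h3⟩ := (add_eq_zero_iff_of_nonneg (by positivity) (by positivity)).1 h
  obtain ⟨h, h4⟩ := (add_eq_zero_iff_of_nonneg (by positivity) (by positivity)).1 h
  obtain ⟨h, h5⟩ := (add_eq_zero_iff_of_nonneg (by positivity) (by positivity)).1 h
  obtain ⟨h, h1⟩ := (add_eq_zero_iff_of_nonneg (by positivity) (by positivity)).1 h
  obtain ⟨h0, h2⟩ := (add_eq_zero_iff_of_nonneg (by positivity) (by positivity)).1 h
  replace h3 := key (by norm_num) h3
  replace h2 := key (by norm_num) h2
  replace h0 := key (by norm_num) h0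
  replace h1 := key (by norm_num) h1
  replace h4 := key (by norm_num) h4
  replace h5 := key (by norm_num) h5
  funext i
  fin_cases i <;> simp <;> linarith

theorem isRedundantlyExtreme_E₆ {Λ : Submodule ℤ (EuclideanSpace ℝ (Fin 6))}
    (hΛ : IsRootLattice CartanMatrix.E₆ Λ) : IsRedundantlyExtreme (minimalConfiguration Λ) := by
  have hchain : ∀ i j : Fin 6, i = j ∨
      cartanForm CartanMatrix.E₆ (Pi.single i 1 + Pi.single j 1) = 2 ∨
      IsRootChain CartanMatrix.E₆ i (pathInterior i j) j := by decide +kernel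
  refine isRedundantlyExtreme_of_framePair (F := frameE 6) (F' := frameE' 6)
    (s := padded 6 [1, 1, 1, 1, 1, 1]) (s' := padded 6 [1, 1, 1, 2, 1])
    CartanMatrix.E₆_diag (fun c => eq_zero_of_E₆_form)
    (fun i j => (hchain i j).imp_right (Or.imp_right fun h => ⟨_, h⟩)) ?_
    (by decide +kernel) (by decide +kernel) (by decide +kernel) (by decide +kernel)
    (by decide +kernel) (by decide +kernel) (by decide +kernel) hΛ
  intro P h0 h
  have h2 := h 0 2 (by decide) h0
  have h3 := h 2 3 (by decide) h2
  have h1 := h 3 1 (by decide) h3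
  have h4 := h 3 4 (by decide) h3
  have h5 := h 4 5 (by decide) h4
  intro i
  fin_cases i <;> assumption

theorem eq_zero_of_E₇_form {c : Fin 7 → ℝ}
    (h : ∑ i, ∑ j, c i * c j * (CartanMatrix.E₇ i j : ℝ) = 0) : c = 0 := by
  rw [E₇_form] at h
  have key : ∀ {a x : ℝ}, a ≠ 0 → a * x ^ 2 = 0 → x = 0 := fun ha hx => by simpa [ha] using hx
  obtain ⟨h, h3⟩ := (add_eq_zero_iff_of_nonneg (by positivity) (by positivity)).1 h
  obtain ⟨h, h4⟩ := (add_eq_zero_iff_of_nonneg (by positivity) (by positivity)).1 h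
  obtain ⟨h, h5⟩ := (add_eq_zero_iff_of_nonneg (by positivity) (by positivity)).1 h
  obtain ⟨h, h6⟩ := (add_eq_zero_iff_of_nonneg (by positivity) (by positivity)).1 h
  obtain ⟨h, h1⟩ := (add_eq_zero_iff_of_nonneg (by positivity) (by positivity)).1 h
  obtain ⟨h0, h2⟩ := (add_eq_zero_iff_of_nonneg (by positivity) (by positivity)).1 h
  replace h3 := key (by norm_num) h3
  replace h2 := key (by norm_num) h2
  replace h0 := key (by norm_num) h0
  replace h1 := key (by norm_num) h1
  replace h4 := key (by norm_num) h4
  replace h5 := key (by norm_num) h5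
  replace h6 := key (by norm_num) h6
  funext i
  fin_cases i <;> simp <;> linarith

theorem isRedundantlyExtreme_E₇ {Λ : Submodule ℤ (EuclideanSpace ℝ (Fin 7))}
    (hΛ : IsRootLattice CartanMatrix.E₇ Λ) : IsRedundantlyExtreme (minimalConfiguration Λ) := by
  have hchain : ∀ i j : Fin 7, i = j ∨
      cartanForm CartanMatrix.E₇ (Pi.single i 1 + Pi.single j 1) = 2 ∨
      IsRootChain CartanMatrix.E₇ i (pathInterior i j) j := by decide +kernel
  refine isRedundantlyExtreme_of_framePair (F := frameE 7) (F' := frameE' 7)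
    (s := padded 7 [1, 1, 1, 1, 1, 1]) (s' := padded 7 [1, 1, 1, 2, 1])
    CartanMatrix.E₇_diag (fun c => eq_zero_of_E₇_form)
    (fun i j => (hchain i j).imp_right (Or.imp_right fun h => ⟨_, h⟩)) ?_
    (by decide +kernel) (by decide +kernel) (by decide +kernel) (by decide +kernel)
    (by decide +kernel) (by decide +kernel) (by decide +kernel) hΛ
  intro P h0 h
  have h2 := h 0 2 (by decide) h0
  have h3 := h 2 3 (by decide) h2
  have h1 := h 3 1 (by decide) h3
  have h4 := h 3 4 (by decide) h3
  have h5 := h 4 5 (by decide) h4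
  have h6 := h 5 6 (by decide) h5
  intro i
  fin_cases i <;> assumption

theorem eq_zero_of_E₈_form {c : Fin 8 → ℝ}
    (h : ∑ i, ∑ j, c i * c j * (CartanMatrix.E₈ i j : ℝ) = 0) : c = 0 := by
  rw [E₈_form] at h
  have key : ∀ {a x : ℝ}, a ≠ 0 → a * x ^ 2 = 0 → x = 0 := fun ha hx => by simpa [ha] using hx
  obtain ⟨h, h3⟩ := (add_eq_zero_iff_of_nonneg (by positivity) (by positivity)).1 h
  obtain ⟨h, h4⟩ := (add_eq_zero_iff_of_nonneg (by positivity) (by positivity)).1 h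
  obtain ⟨h, h5⟩ := (add_eq_zero_iff_of_nonneg (by positivity) (by positivity)).1 h
  obtain ⟨h, h6⟩ := (add_eq_zero_iff_of_nonneg (by positivity) (by positivity)).1 h
  obtain ⟨h, h7⟩ := (add_eq_zero_iff_of_nonneg (by positivity) (by positivity)).1 h
  obtain ⟨h, h1⟩ := (add_eq_zero_iff_of_nonneg (by positivity) (by positivity)).1 h
  obtain ⟨h0, h2⟩ := (add_eq_zero_iff_of_nonneg (by positivity) (by positivity)).1 h
  replace h3 := key (by norm_num) h3
  replace h2 := key (by norm_num) h2
  replace h0 := key (by norm_num) h0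
  replace h1 := key (by norm_num) h1
  replace h4 := key (by norm_num) h4
  replace h5 := key (by norm_num) h5
  replace h6 := key (by norm_num) h6
  replace h7 := key (by norm_num) h7
  funext i
  fin_cases i <;> simp <;> linarith

theorem isRedundantlyExtreme_E₈ {Λ : Submodule ℤ (EuclideanSpace ℝ (Fin 8))}
    (hΛ : IsRootLattice CartanMatrix.E₈ Λ) : IsRedundantlyExtreme (minimalConfiguration Λ) := by
  have hchain : ∀ i j : Fin 8, i = j ∨
      cartanForm CartanMatrix.E₈ (Pi.single i 1 + Pi.single j 1) = 2 ∨
      IsRootChain CartanMatrix.E₈ i (pathInterior i j) j := by decide +kernel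
  refine isRedundantlyExtreme_of_framePair (F := frameE 8) (F' := frameE' 8)
    (s := padded 8 [1, 1, 1, 1, 1, 1]) (s' := padded 8 [1, 1, 1, 2, 1])
    CartanMatrix.E₈_diag (fun c => eq_zero_of_E₈_form)
    (fun i j => (hchain i j).imp_right (Or.imp_right fun h => ⟨_, h⟩)) ?_
    (by decide +kernel) (by decide +kernel) (by decide +kernel) (by decide +kernel)
    (by decide +kernel) (by decide +kernel) (by decide +kernel) hΛ
  intro P h0 h
  have h2 := h 0 2 (by decide) h0
  have h3 := h 2 3 (by decide) h2
  have h1 := h 3 1 (by decide) h3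
  have h4 := h 3 4 (by decide) h3
  have h5 := h 4 5 (by decide) h4
  have h6 := h 5 6 (by decide) h5
  have h7 := h 6 7 (by decide) h6
  intro i
  fin_cases i <;> assumption

end Exceptional

/-! ### The lattices `A_n` via a regular simplex. -/

section TypeA

variable {E : Type*} [NormedAddCommGroup E] [InnerProductSpace ℝ E]

theorem exists_of_sum_sq_eq_two {ι : Type*} [Fintype ι] {m : ι → ℤ} (h : ∑ i, m i ^ 2 = 2) :
    ∃ i j, i ≠ j ∧ m i ^ 2 = 1 ∧ m j ^ 2 = 1 ∧ ∀ k, k ≠ i → k ≠ j → m k = 0 := by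
  classical
  have hsq : ∀ k : ℤ, 0 < k ^ 2 → k ^ 2 ≤ 2 → k ^ 2 = 1 := fun k h1 h2 => by
    have h3 : k ≤ 1 := by nlinarith
    have h4 : -1 ≤ k := by nlinarith
    interval_cases k <;> simp_all
  have hex : ∀ s : Finset ι, 0 < ∑ i ∈ s, m i ^ 2 → ∃ i ∈ s, 0 < m i ^ 2 := fun s hs => by
    by_contra! hall
    exact absurd hs (not_lt.2 (Finset.sum_nonpos hall))
  have hle : ∀ (s : Finset ι), ∀ i ∈ s, m i ^ 2 ≤ ∑ i ∈ s, m i ^ 2 := fun s i hi =>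
    Finset.single_le_sum (f := fun i => m i ^ 2) (fun _ _ => sq_nonneg _) hi
  obtain ⟨i, hi, hpos⟩ := hex Finset.univ (by rw [h]; norm_num)
  have hi1 := hsq _ hpos (h ▸ hle _ i hi)
  have hrest : ∑ k ∈ Finset.univ.erase i, m k ^ 2 = 1 := by
    have := Finset.add_sum_erase _ (fun i => m i ^ 2) hi
    linarith
  obtain ⟨j, hj, hjpos⟩ := hex _ (by rw [hrest]; norm_num)
  have hj1 := hsq _ hjpos ((hle _ j hj).trans (by rw [hrest]; norm_num))
  have hrest2 : ∑ k ∈ (Finset.univ.erase i).erase j, m k ^ 2 = 0 := by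
    have := Finset.add_sum_erase _ (fun i => m i ^ 2) hj
    linarith
  refine ⟨i, j, (Finset.ne_of_mem_erase hj).symm, hi1, hj1, fun k hki hkj => ?_⟩
  have := (Finset.sum_eq_zero_iff_of_nonneg fun _ _ => sq_nonneg _).1 hrest2 k (by simp [hki, hkj])
  simpa using this

/-- The edge vectors of `q` are those of a regular simplex with unit edges and `q 0 = 0`. -/
def IsSimplex {n : ℕ} (q : Fin (n + 1) → E) : Prop :=
  -- This is the Gram matrix of the vectors `e_k - e_0`; the model is `q k = (e_k - e_0)/√2`.
  ∀ k l, 2 * ⟪q k, q l⟫ = (if k = l then 1 else 0) - (if l = 0 then 1 else 0) -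
    (if k = 0 then 1 else 0) + 1

/-- The simple roots of type `A` attached to a simplex. -/
def edges {n : ℕ} (q : Fin (n + 1) → E) (i : Fin n) : E := q i.succ - q i.castSucc

theorem IsSimplex.inner_sub_sub {n : ℕ} {q : Fin (n + 1) → E} (hq : IsSimplex q)
    (i j k l : Fin (n + 1)) : 2 * ⟪q i - q j, q k - q l⟫ = (if i = k then 1 else 0) +
      (if j = l then 1 else 0) - (if i = l then 1 else 0) - (if j = k then 1 else 0) := by
  simp only [inner_sub_left, inner_sub_right, mul_sub, hq i k, hq i l, hq j k, hq j l]
  ring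

theorem IsSimplex.inner_edges {n : ℕ} {q : Fin (n + 1) → E} (hq : IsSimplex q) (i j : Fin n) :
    ⟪edges q i, edges q j⟫ = (CartanMatrix.A n i j : ℝ) / 2 := by
  have := hq.inner_sub_sub i.succ i.castSucc j.succ j.castSucc
  rw [edges, edges, eq_div_iff two_ne_zero, mul_comm, this]
  simp only [Fin.ext_iff, Fin.val_succ, Fin.val_castSucc, CartanMatrix.A, Matrix.of_apply]
  split_ifs <;> first | omega | norm_num

theorem isSimplex_of_gram {n : ℕ} {a : Fin n → E}
    (h : ∀ i j, ⟪a i, a j⟫ = (CartanMatrix.A n i j : ℝ) / 2) :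
    ∃ q : Fin (n + 1) → E, IsSimplex q ∧ a = edges q := by
  -- The vertices are the partial sums of the simple roots, starting from `0`.
  let q : Fin (n + 1) → E := fun k => Fin.induction (motive := fun _ => E) 0 (fun i x => x + a i) k
  have hq0 : q 0 = 0 := rfl
  have hqs : ∀ i : Fin n, q i.succ = q i.castSucc + a i := fun i => by
    simp only [q, Fin.induction_succ]
  have h1 : ∀ (i : Fin n) (l : Fin (n + 1)), 2 * ⟪a i, q l⟫ = (if i.succ = l then 1 else 0) -
      (if i.castSucc = l then 1 else 0) + if i.castSucc = 0 then 1 else 0 := by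
    intro i l
    induction l using Fin.induction with
    | zero => rw [hq0, inner_zero_right]; simp [Fin.succ_ne_zero]
    | succ l ih =>
      rw [hqs, inner_add_right, mul_add, ih, h]
      simp only [Fin.ext_iff, Fin.val_succ, Fin.val_castSucc, CartanMatrix.A, Matrix.of_apply,
        Fin.val_zero]
      split_ifs <;> first | omega | norm_num
  refine ⟨q, fun k l => ?_, funext fun i => by rw [edges, hqs, add_sub_cancel_left]⟩
  induction k using Fin.induction with
  | zero => rw [hq0, inner_zero_left]; simp [eq_comm]
  | succ k ih =>
    rw [hqs, inner_add_left, mul_add, ih, h1]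
    simp only [Fin.succ_ne_zero, if_false]
    ring

theorem exists_isSimplex (n : ℕ) : ∃ q : Fin (n + 1) → EuclideanSpace ℝ (Fin n), IsSimplex q := by
  rcases Nat.eq_zero_or_pos n with rfl | hn
  · exact ⟨0, fun k l => by simp [Fin.fin_one_eq_zero k, Fin.fin_one_eq_zero l]⟩
  have hn' : (0 : ℝ) < n := by exact_mod_cast hn
  -- The root of `n c² + 2c = 1`: with `u` the all-ones vector, `e_i + c u` and `e_j + c u` then
  -- have inner product `δ_ij + 1`.
  set c : ℝ := (√(1 + n) - 1) / n with hc
  have hc2 : 2 * c + n * c ^ 2 = 1 := by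
    have hs : √(1 + n : ℝ) ^ 2 = 1 + n := Real.sq_sqrt (by positivity)
    rw [hc]
    field_simp
    linarith
  let u : EuclideanSpace ℝ (Fin n) := WithLp.toLp 2 fun _ => 1
  let e : Fin n → EuclideanSpace ℝ (Fin n) := fun i => EuclideanSpace.single i 1
  have huu : ⟪u, u⟫ = n := by simp [u, PiLp.inner_apply, -inner_self_eq_norm_sq_to_K]
  have heu : ∀ i, ⟪e i, u⟫ = 1 := fun i => by simp [u, e, EuclideanSpace.inner_single_left]
  have hue : ∀ i, ⟪u, e i⟫ = 1 := fun i => by rw [real_inner_comm, heu]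
  have hee : ∀ i j, ⟪e i, e j⟫ = if i = j then 1 else 0 :=
    orthonormal_iff_ite.1 (EuclideanSpace.orthonormal_single)
  have h2 : (√2)⁻¹ * ((√2)⁻¹ * (2 : ℝ)) = 1 := by
    have : √2 * √2 = (2 : ℝ) := Real.mul_self_sqrt (by norm_num)
    field_simp
    nlinarith
  refine ⟨Fin.cases 0 fun i => (√2)⁻¹ • (e i + c • u), fun k l => ?_⟩
  induction k using Fin.cases with
  | zero => simp [eq_comm]
  | succ k =>
    induction l using Fin.cases with
    | zero => simp [Fin.succ_ne_zero]
    | succ l =>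
      simp only [Fin.cases_succ, real_inner_smul_left, real_inner_smul_right, inner_add_left,
        inner_add_right, huu, heu, hue, hee, Fin.succ_inj, Fin.succ_ne_zero, if_false]
      linear_combination ((if k = l then 1 else 0) + (2 * c + n * c ^ 2)) * h2 + hc2

theorem IsSimplex.linearIndependent {n : ℕ} {q : Fin (n + 1) → E} (hq : IsSimplex q) :
    LinearIndependent ℝ fun i : Fin n => q i.succ := by
  rw [Fintype.linearIndependent_iff]
  intro c hc
  have h0 : 2 * ⟪∑ i, c i • q i.succ, ∑ i, c i • q i.succ⟫ = 0 := by rw [hc]; simp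
  have h1 : 2 * ⟪∑ i, c i • q i.succ, ∑ i, c i • q i.succ⟫ = ∑ i, c i ^ 2 + (∑ i, c i) ^ 2 := by
    simp only [sum_inner, inner_sum, real_inner_smul_left, real_inner_smul_right, Finset.mul_sum]
    have : ∀ i j : Fin n, 2 * (c i * (c j * ⟪q j.succ, q i.succ⟫)) =
        (if j = i then c i * c j else 0) + c i * c j := fun i j => by
      have := hq j.succ i.succ
      simp only [Fin.succ_inj, Fin.succ_ne_zero, if_false] at this
      rw [show 2 * (c i * (c j * ⟪q j.succ, q i.succ⟫)) =
        c i * c j * (2 * ⟪q j.succ, q i.succ⟫) by ring, this]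
      split_ifs <;> ring
    simp only [this, Finset.sum_add_distrib, Finset.sum_ite_eq', Finset.mem_univ, if_true]
    rw [pow_two (∑ i, c i), Finset.sum_mul_sum]
    simp only [pow_two]
  rw [h1] at h0
  have h2 := ((add_eq_zero_iff_of_nonneg (Finset.sum_nonneg fun i _ => sq_nonneg (c i))
    (sq_nonneg _)).1 h0).1
  intro i
  have := (Finset.sum_eq_zero_iff_of_nonneg fun i _ => sq_nonneg (c i)).1 h2 i (Finset.mem_univ i)
  simpa using this

theorem sub_mem_span_edges {E : Type*} [AddCommGroup E] {n : ℕ} {q : Fin (n + 1) → E}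
    {R : Type*} [Ring R] [Module R E] {W : Submodule R E}
    (hW : ∀ i : Fin n, q i.succ - q i.castSucc ∈ W) (k l : Fin (n + 1)) : q k - q l ∈ W := by
  have h0 : ∀ k, q k - q 0 ∈ W := by
    intro k
    induction k using Fin.induction with
    | zero => simp
    | succ k ih => simpa using add_mem (hW k) ih
  simpa using sub_mem (h0 k) (h0 l)

theorem IsSimplex.zero {n : ℕ} {q : Fin (n + 1) → E} (hq : IsSimplex q) : q 0 = 0 := by
  have := hq 0 0
  simp only [if_true, sub_self, zero_sub, neg_add_cancel, mul_eq_zero, inner_self_eq_zero] at this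
  exact this.resolve_left two_ne_zero

theorem exists_coeff_of_mem_span_edges {E : Type*} [NormedAddCommGroup E] {n : ℕ}
    {q : Fin (n + 1) → E} {x : E}
    (hx : x ∈ Submodule.span ℤ (Set.range (edges q))) :
    ∃ m : Fin (n + 1) → ℤ, ∑ k, m k = 0 ∧ x = ∑ k, m k • q k := by
  induction hx using Submodule.span_induction with
  | mem x hx =>
    obtain ⟨i, rfl⟩ := hx
    refine ⟨Pi.single i.succ 1 - Pi.single i.castSucc 1, by simp, ?_⟩
    simp [edges, sub_smul, Pi.single_apply, ite_smul]
  | zero => exact ⟨0, by simp, by simp⟩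
  | add x y _ _ hx hy =>
    obtain ⟨m, h1, rfl⟩ := hx
    obtain ⟨m', h2, rfl⟩ := hy
    exact ⟨m + m', by simp [Finset.sum_add_distrib, h1, h2],
      by simp [add_smul, Finset.sum_add_distrib]⟩
  | smul r x _ hx =>
    obtain ⟨m, h1, rfl⟩ := hx
    exact ⟨r • m, by simp [← Finset.mul_sum, h1], by simp [mul_smul, Finset.smul_sum]⟩

/-- For coefficients of sum zero the constant and index-`0` terms of the Gram matrix cancel, and the
form becomes that of `ℤ^(n+1)` on the sum-zero hyperplane. -/
theorem IsSimplex.inner_self_comb {n : ℕ} {q : Fin (n + 1) → E} (hq : IsSimplex q)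
    {m : Fin (n + 1) → ℤ} (hm : ∑ k, m k = 0) :
    2 * ⟪∑ k, m k • q k, ∑ k, m k • q k⟫ = ((∑ k, m k ^ 2 : ℤ) : ℝ) := by
  have hm' : ∑ k, (m k : ℝ) = 0 := by exact_mod_cast hm
  simp only [← Int.cast_smul_eq_zsmul ℝ, sum_inner, inner_sum, real_inner_smul_left,
    real_inner_smul_right, Finset.mul_sum]
  have : ∀ i j, 2 * ((m i : ℝ) * (m j * ⟪q j, q i⟫)) = (if j = i then (m i : ℝ) * m j else 0) -
      (if i = 0 then (m i : ℝ) else 0) * m j - m i * (if j = 0 then (m j : ℝ) else 0) +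
      m i * m j := fun i j => by
    rw [show 2 * ((m i : ℝ) * (m j * ⟪q j, q i⟫)) = m i * m j * (2 * ⟪q j, q i⟫) by ring, hq j i]
    split_ifs <;> ring
  simp only [this, Finset.sum_add_distrib, Finset.sum_sub_distrib, ← Finset.mul_sum, hm',
    ← Finset.sum_mul, mul_zero, zero_mul, Finset.sum_ite_eq', Finset.mem_univ, if_true]
  push_cast
  simp only [pow_two]
  ring

/-- Norm one forces `∑ m_k² = 2` together with `∑ m_k = 0`, so one coefficient is `1`, one is `-1`,
and the others vanish. -/
theorem IsSimplex.unitVectors_eq {n : ℕ} {q : Fin (n + 1) → E} (hq : IsSimplex q) :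
    unitVectors (Submodule.span ℤ (Set.range (edges q))) =
      (fun p : Fin (n + 1) × Fin (n + 1) => q p.1 - q p.2) ''
        ((Finset.univ : Finset (Fin (n + 1))).offDiag : Set _) := by
  ext x
  rw [mem_unitVectors_iff]
  constructor
  · rintro ⟨hx, hx1⟩
    obtain ⟨m, hm, rfl⟩ := exists_coeff_of_mem_span_edges hx
    have h2 := hq.inner_self_comb hm
    rw [hx1, mul_one] at h2
    obtain ⟨i, j, hij, hi, hj, hk⟩ := exists_of_sum_sq_eq_two (m := m) (by exact_mod_cast h2.symm)
    have hm2 : m i + m j = 0 := by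
      rw [← hm, Fintype.sum_eq_add i j hij fun k hk' => hk k hk'.1 hk'.2]
    rw [Fintype.sum_eq_add i j hij fun k hk' => by rw [hk k hk'.1 hk'.2, zero_smul],
      eq_neg_of_add_eq_zero_right hm2]
    rcases (show m i = 1 ∨ m i = -1 from sq_eq_one_iff.1 hi) with h | h
    · exact ⟨(i, j), by simpa using hij, by simp [h, sub_eq_add_neg]⟩
    · exact ⟨(j, i), by simpa using hij.symm, by simp [h, sub_eq_neg_add]⟩
  · rintro ⟨⟨i, j⟩, hij, rfl⟩
    have hij' : i ≠ j := by simpa using hij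
    refine ⟨sub_mem_span_edges (q := q) (W := Submodule.span ℤ (Set.range (edges q)))
      (fun i => Submodule.subset_span (Set.mem_range_self i)) i j, ?_⟩
    have := hq.inner_sub_sub i j i j
    simp only [if_true, hij', hij'.symm, if_false] at this
    linarith

theorem IsSimplex.ncard_unitVectors {n : ℕ} {q : Fin (n + 1) → E} (hq : IsSimplex q) :
    (unitVectors (Submodule.span ℤ (Set.range (edges q)))).ncard = n * (n + 1) := by
  rw [hq.unitVectors_eq, Set.InjOn.ncard_image, Set.ncard_coe_finset, Finset.offDiag_card]
  · simp only [Finset.card_univ, Fintype.card_fin]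
    rw [← Nat.sub_one_mul]
    simp
  · rintro ⟨i, j⟩ hij ⟨k, l⟩ hkl h
    have hij' : i ≠ j := by simpa using hij
    have hkl' : k ≠ l := by simpa using hkl
    simp only at h
    have h1 := hq.inner_sub_sub i j k l
    have h2 := hq.inner_sub_sub i j i j
    rw [← h, h2] at h1
    simp only [if_true, hij', hij'.symm, if_false] at h1
    rw [Prod.mk.injEq]
    by_contra hne
    rw [not_and_or] at hne
    split_ifs at h1 <;> first | (norm_num at h1; done) | simp_all

theorem isMinimallyExtreme_of_isSimplex {n : ℕ} (hn : 0 < n)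
    {q : Fin (n + 1) → EuclideanSpace ℝ (Fin n)} (hq : IsSimplex q) :
    IsMinimallyExtreme (minimalConfiguration (Submodule.span ℤ (Set.range (edges q)))) := by
  have : NeZero n := ⟨hn.ne'⟩
  have hdiag : ∀ i, CartanMatrix.A n i i = 2 := fun i => by simp [CartanMatrix.A]
  rw [minimalConfiguration_span_eq hq.inner_edges hdiag]
  have hspan : Submodule.span ℝ (Set.range fun i : Fin n => q i.succ) = ⊤ := by
    obtain ⟨b, hb⟩ := exists_basis_coe_eq hq.linearIndependent
    rw [← hb, b.span_eq]
  have hfin : (unitVectors (Submodule.span ℤ (Set.range (edges q)))).Finite := by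
    rw [hq.unitVectors_eq]
    exact (Finset.finite_toSet _).image _
  have hmem : ∀ i j, i ≠ j → q i - q j ∈ unitVectors (Submodule.span ℤ (Set.range (edges q))) :=
    fun i j hij => by
      rw [hq.unitVectors_eq]
      exact ⟨(i, j), by simpa using hij, rfl⟩
  have hmem0 : ∀ i : Fin n, q i.succ ∈ unitVectors (Submodule.span ℤ (Set.range (edges q))) :=
    fun i => by simpa [hq.zero] using hmem i.succ 0 (Fin.succ_ne_zero i)
  have hp : IsPerfect (unitVectors (Submodule.span ℤ (Set.range (edges q)))) := by
    -- The `q i.succ` form a basis of roots in which any two distinct members differ by a root.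
    refine isPerfect_of_symmProd_mem (isConfiguration_unitVectors hfin) hspan fun i j => ?_
    rcases eq_or_ne i j with rfl | hij
    · rw [symmProd_self]
      exact Submodule.smul_mem _ _ (proj_mem_span (hmem0 i))
    · exact symmProd_mem_span_of_sub_mem (hmem0 i) (hmem0 j)
        (hmem _ _ fun h => hij (Fin.succ_injective n h))
  refine ⟨isExtreme_unitVectors hp (isHalfIntegral_span hq.inner_edges), ?_⟩
  rw [hq.ncard_unitVectors]
  simp

theorem exists_isRootLattice_A (n : ℕ) : ∃ Λ, IsRootLattice (CartanMatrix.A n) Λ := by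
  obtain ⟨q, hq⟩ := exists_isSimplex n
  exact ⟨_, edges q, hq.inner_edges, rfl⟩

theorem isMinimallyExtreme_A {n : ℕ} (hn : 0 < n)
    {Λ : Submodule ℤ (EuclideanSpace ℝ (Fin n))} (hΛ : IsRootLattice (CartanMatrix.A n) Λ) :
    IsMinimallyExtreme (minimalConfiguration Λ) := by
  obtain ⟨a, ha, rfl⟩ := hΛ
  obtain ⟨q, hq, rfl⟩ := isSimplex_of_gram ha
  exact isMinimallyExtreme_of_isSimplex hn hq

end TypeA

/-! ### The lattices `D_n` via an orthogonal frame. -/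

section TypeD

variable {E : Type*} [NormedAddCommGroup E] [InnerProductSpace ℝ E] {m : ℕ}

/-- The simple roots of type `D` in terms of the vectors `w` of an orthogonal frame. -/
def dRoot {E : Type*} [AddCommGroup E] (w : Fin (m + 2) → E) : Fin (m + 2) → E :=
  Fin.lastCases (w (Fin.last m).castSucc + w (Fin.last (m + 1)))
    fun i : Fin (m + 1) => w i.castSucc - w i.succ

theorem dRoot_last {E : Type*} [AddCommGroup E] (w : Fin (m + 2) → E) :
    dRoot w (Fin.last (m + 1)) = w (Fin.last m).castSucc + w (Fin.last (m + 1)) := by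
  simp [dRoot]

theorem dRoot_castSucc {E : Type*} [AddCommGroup E] (w : Fin (m + 2) → E) (i : Fin (m + 1)) :
    dRoot w i.castSucc = w i.castSucc - w i.succ := by
  simp [dRoot]

/-- The root lattice of type `D`. -/
def dLattice {E : Type*} [AddCommGroup E] (w : Fin (m + 2) → E) : Submodule ℤ E :=
  Submodule.span ℤ (Set.range (dRoot w))

/-- The vectors `w i` are pairwise orthogonal, with squared norm `1/2`. -/
def IsHalfFrame {ι : Type*} [DecidableEq ι] (w : ι → E) : Prop :=
  ∀ i j, ⟪w i, w j⟫ = if i = j then 1 / 2 else 0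

theorem IsHalfFrame.inner_dRoot {w : Fin (m + 2) → E} (hw : IsHalfFrame w) (hm : 1 ≤ m)
    (i j : Fin (m + 2)) : ⟪dRoot w i, dRoot w j⟫ = (CartanMatrix.D (m + 2) i j : ℝ) / 2 := by
  induction i using Fin.lastCases with
  | last =>
    induction j using Fin.lastCases with
    | last =>
      simp only [dRoot_last, inner_add_left, inner_add_right, hw _ _, CartanMatrix.D_diag,
        Fin.ext_iff, Fin.val_last, Fin.val_castSucc]
      split_ifs <;> first | omega | norm_num
    | cast j =>
      have := j.isLt
      simp only [dRoot_last, dRoot_castSucc, inner_add_left, inner_sub_right, hw _ _,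
        CartanMatrix.D, Matrix.of_apply, Fin.ext_iff, Fin.val_last, Fin.val_castSucc, Fin.val_succ,
        or_true, and_true]
      split_ifs <;> first | omega | norm_num
  | cast i =>
    have := i.isLt
    induction j using Fin.lastCases with
    | last =>
      simp only [dRoot_last, dRoot_castSucc, inner_add_right, inner_sub_left, hw _ _,
        CartanMatrix.D, Matrix.of_apply, Fin.ext_iff, Fin.val_last, Fin.val_castSucc, Fin.val_succ,
        or_true, and_true]
      split_ifs <;> first | omega | norm_num
    | cast j =>
      have := j.isLt
      have hD : CartanMatrix.D (m + 2) i.castSucc j.castSucc = if i.val = j.val then 2 else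
          if i.val + 1 = j.val ∨ j.val + 1 = i.val then -1 else 0 := by
        simp only [CartanMatrix.D, Matrix.of_apply, Fin.ext_iff, Fin.val_castSucc]
        split_ifs <;> first | rfl | omega
      rw [hD]
      simp only [dRoot_castSucc, inner_sub_right, inner_sub_left, hw _ _, Fin.ext_iff,
        Fin.val_castSucc, Fin.val_succ]
      split_ifs <;> first | omega | norm_num

theorem sub_mem_dLattice {E : Type*} [AddCommGroup E] (w : Fin (m + 2) → E) (i j : Fin (m + 2)) :
    w i - w j ∈ dLattice w := by
  refine sub_mem_span_edges (q := w) (W := dLattice w) (fun i => ?_) i j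
  have : dRoot w i.castSucc ∈ dLattice w := Submodule.subset_span (Set.mem_range_self _)
  rw [dRoot_castSucc] at this
  simpa using neg_mem this

theorem add_mem_dLattice {E : Type*} [AddCommGroup E] (w : Fin (m + 2) → E) (i j : Fin (m + 2)) :
    w i + w j ∈ dLattice w := by
  have : dRoot w (Fin.last (m + 1)) ∈ dLattice w := Submodule.subset_span (Set.mem_range_self _)
  rw [dRoot_last] at this
  have h := add_mem (add_mem (sub_mem_dLattice w i (Fin.last m).castSucc)
    (sub_mem_dLattice w j (Fin.last (m + 1)))) this
  convert h using 1
  abel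

theorem smul_add_smul_mem_dLattice {E : Type*} [AddCommGroup E] (w : Fin (m + 2) → E)
    (i j : Fin (m + 2)) {s t : ℤ} (hs : s ^ 2 = 1) (ht : t ^ 2 = 1) :
    s • w i + t • w j ∈ dLattice w := by
  rcases sq_eq_one_iff.1 hs with rfl | rfl <;> rcases sq_eq_one_iff.1 ht with rfl | rfl
  · simpa using add_mem_dLattice w i j
  · simpa [sub_eq_add_neg] using sub_mem_dLattice w i j
  · simpa [sub_eq_neg_add] using sub_mem_dLattice w j i
  · simpa [add_comm] using neg_mem (add_mem_dLattice w i j)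

theorem exists_coeff_of_mem_dLattice {E : Type*} [AddCommGroup E] {w : Fin (m + 2) → E} {x : E}
    (hx : x ∈ dLattice w) : ∃ z : Fin (m + 2) → ℤ, x = ∑ i, z i • w i := by
  have : dLattice w ≤ Submodule.span ℤ (Set.range w) := by
    refine Submodule.span_le.2 ?_
    rintro _ ⟨i, rfl⟩
    have hw : ∀ i, w i ∈ Submodule.span ℤ (Set.range w) := fun i => Submodule.subset_span ⟨i, rfl⟩
    induction i using Fin.lastCases with
    | last => rw [dRoot_last]; exact add_mem (hw _) (hw _)
    | cast i => rw [dRoot_castSucc]; exact sub_mem (hw _) (hw _)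
  obtain ⟨z, hz⟩ := (Submodule.mem_span_range_iff_exists_fun ℤ).1 (this hx)
  exact ⟨z, hz.symm⟩

theorem IsHalfFrame.inner_comb {ι : Type*} [Fintype ι] [DecidableEq ι] {w : ι → E}
    (hw : IsHalfFrame w) (z : ι → ℤ) (i : ι) : ⟪∑ k, z k • w k, w i⟫ = z i / 2 := by
  simp only [← Int.cast_smul_eq_zsmul ℝ, sum_inner, real_inner_smul_left, hw _ _, mul_ite,
    mul_zero, Finset.sum_ite_eq', Finset.mem_univ, if_true]
  ring

theorem IsHalfFrame.inner_self_comb {ι : Type*} [Fintype ι] [DecidableEq ι] {w : ι → E}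
    (hw : IsHalfFrame w) (z : ι → ℤ) :
    ⟪∑ k, z k • w k, ∑ k, z k • w k⟫ = ((∑ k, z k ^ 2 : ℤ) : ℝ) / 2 := by
  rw [inner_sum]
  simp only [← Int.cast_smul_eq_zsmul ℝ (_ : ℤ) (w _), real_inner_smul_right]
  simp only [Int.cast_smul_eq_zsmul, hw.inner_comb]
  push_cast
  rw [Finset.sum_div]
  exact Finset.sum_congr rfl fun i _ => by ring

theorem IsHalfFrame.mem_unitVectors_iff {w : Fin (m + 2) → E} (hw : IsHalfFrame w) {x : E} :
    x ∈ unitVectors (dLattice w) ↔ ∃ i j, i ≠ j ∧ ∃ s t : ℤ, s ^ 2 = 1 ∧ t ^ 2 = 1 ∧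
      x = s • w i + t • w j := by
  rw [PerfectEutactic.mem_unitVectors_iff]
  constructor
  · rintro ⟨hx, hx1⟩
    obtain ⟨z, rfl⟩ := exists_coeff_of_mem_dLattice hx
    rw [hw.inner_self_comb] at hx1
    have h2 : ((∑ k, z k ^ 2 : ℤ) : ℝ) = 2 := by linarith
    obtain ⟨i, j, hij, hi, hj, hk⟩ := exists_of_sum_sq_eq_two (m := z) (by exact_mod_cast h2)
    exact ⟨i, j, hij, z i, z j, hi, hj,
      Fintype.sum_eq_add i j hij fun k hk' => by rw [hk k hk'.1 hk'.2, zero_smul]⟩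
  · rintro ⟨i, j, hij, s, t, hs, ht, rfl⟩
    refine ⟨smul_add_smul_mem_dLattice w i j hs ht, ?_⟩
    have hs' : (s : ℝ) ^ 2 = 1 := by exact_mod_cast hs
    have ht' : (t : ℝ) ^ 2 = 1 := by exact_mod_cast ht
    simp only [← Int.cast_smul_eq_zsmul ℝ, inner_add_left, inner_add_right, real_inner_smul_left,
      real_inner_smul_right, hw _ _, hij, hij.symm, if_true, if_false]
    linear_combination (hs' + ht') / 2

theorem IsHalfFrame.linearIndependent {ι : Type*} [Fintype ι] [DecidableEq ι] {w : ι → E}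
    (hw : IsHalfFrame w) : LinearIndependent ℝ w := by
  rw [Fintype.linearIndependent_iff]
  intro c hc i
  have := congrArg (fun y => ⟪y, w i⟫) hc
  simpa [sum_inner, real_inner_smul_left, hw _ _] using this

theorem span_dRoot_eq_top {w : Fin (m + 2) → E}
    (hspan : Submodule.span ℝ (Set.range w) = ⊤) :
    Submodule.span ℝ (Set.range (dRoot w)) = ⊤ := by
  rw [eq_top_iff, ← hspan, Submodule.span_le]
  rintro _ ⟨i, rfl⟩
  have h : w i + w i ∈ Submodule.span ℝ (Set.range (dRoot w)) :=
    Submodule.span_le_restrictScalars ℤ ℝ _ (add_mem_dLattice w i i)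
  rw [← two_smul ℝ] at h
  exact (Submodule.smul_mem_iff _ two_ne_zero).1 h

theorem IsHalfFrame.exists_basis {w : Fin (m + 2) → E} (hw : IsHalfFrame w)
    (hspan : Submodule.span ℝ (Set.range w) = ⊤) :
    ∃ b : Module.Basis (Fin (m + 2)) ℝ E, ⇑b = dRoot w := by
  have h : Module.finrank ℝ E = Fintype.card (Fin (m + 2)) :=
    Module.finrank_eq_card_basis (Module.Basis.mk hw.linearIndependent hspan.ge)
  exact ⟨basisOfTopLeSpanOfCardEqFinrank _ (span_dRoot_eq_top hspan).ge h.symm, by simp⟩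

theorem exists_isHalfFrame (n : ℕ) : ∃ w : Fin n → EuclideanSpace ℝ (Fin n),
    IsHalfFrame w ∧ Submodule.span ℝ (Set.range w) = ⊤ := by
  have hw : IsHalfFrame fun i : Fin n => (√2)⁻¹ • EuclideanSpace.single i (1 : ℝ) := fun i j => by
    rw [real_inner_smul_left, real_inner_smul_right,
      orthonormal_iff_ite.1 EuclideanSpace.orthonormal_single i j, ← mul_assoc, ← mul_inv,
      Real.mul_self_sqrt zero_le_two]
    simp
  obtain ⟨b, hb⟩ := exists_basis_coe_eq hw.linearIndependent
  exact ⟨_, hw, hb ▸ b.span_eq⟩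

section Config

variable {w : Fin (m + 2) → E} (hw : IsHalfFrame w)
  (hspan : Submodule.span ℝ (Set.range w) = ⊤)

include hw hspan

theorem IsHalfFrame.finite_unitVectors : (unitVectors (dLattice w)).Finite := by
  obtain ⟨b, hb⟩ := hw.exists_basis hspan
  rw [dLattice, ← hb]
  exact finite_unitVectors_span b

/-- The roots `w i ± w j` give, by half-sum and half-difference, `P_{w i} + P_{w j}` and `symmProd
(w i) (w j)`. A third index `k` isolates `2 P_{w i}` as `(ij) + (ik) - (jk)`, which is where `n ≥ 3`
enters. -/
theorem IsHalfFrame.isPerfect (hm : 1 ≤ m) : IsPerfect (unitVectors (dLattice w)) := by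
  obtain ⟨b, -⟩ := hw.exists_basis hspan
  have : FiniteDimensional ℝ E := b.finiteDimensional_of_finite
  set W := Submodule.span ℝ (proj '' unitVectors (dLattice w)) with hW
  have hadd : ∀ i j, i ≠ j → proj (w i) + proj (w j) + symmProd (w i) (w j) ∈ W := fun i j hij => by
    rw [← proj_add]
    exact proj_mem_span (hw.mem_unitVectors_iff.2 ⟨i, j, hij, 1, 1, by simp, by simp, by simp⟩)
  have hsub : ∀ i j, i ≠ j → proj (w i) + proj (w j) - symmProd (w i) (w j) ∈ W := fun i j hij => by
    rw [← proj_sub]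
    exact proj_mem_span (hw.mem_unitVectors_iff.2
      ⟨i, j, hij, 1, -1, by simp, by simp, by simp [sub_eq_add_neg]⟩)
  have hsum : ∀ i j, i ≠ j → proj (w i) + proj (w j) ∈ W := fun i j hij => by
    have := W.smul_mem (1 / 2 : ℝ) (add_mem (hadd i j hij) (hsub i j hij))
    convert this using 1
    module
  refine isPerfect_of_symmProd_mem (isConfiguration_unitVectors (hw.finite_unitVectors hspan))
    hspan fun i j => ?_
  rcases eq_or_ne i j with rfl | hij
  · obtain ⟨j, hj, k, hk, hjk⟩ := Finset.one_lt_card.1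
      (show 1 < ({i}ᶜ : Finset (Fin (m + 2))).card by
        rw [Finset.card_compl, Finset.card_singleton, Fintype.card_fin]; omega)
    rw [Finset.mem_compl, Finset.mem_singleton] at hj hk
    have := sub_mem (add_mem (hsum i j (Ne.symm hj)) (hsum i k (Ne.symm hk))) (hsum j k hjk)
    rw [symmProd_self]
    convert this using 1
    module
  · have := W.smul_mem (1 / 2 : ℝ) (sub_mem (hadd i j hij) (hsub i j hij))
    convert this using 1
    module

theorem IsHalfFrame.isExtreme (hm : 1 ≤ m) : IsExtreme (unitVectors (dLattice w)) := by
  have hp := hw.isPerfect hspan hm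
  have : Nontrivial E := ⟨w 0, 0, hw.linearIndependent.ne_zero 0⟩
  exact isExtreme_unitVectors hp (isHalfIntegral_span (hw.inner_dRoot hm))

/-- The root `s w_i + t w_j` is completed to a frame by `s w_i - t w_j` and `w_k ± w_l`, with
half-sum `s w_i + w_k`. This needs four distinct indices. -/
theorem IsHalfFrame.isSemiEutactic_diff (hm : 2 ≤ m) {x : E}
    (hx : x ∈ unitVectors (dLattice w)) :
    IsSemiEutactic (unitVectors (dLattice w) \ {x, -x}) := by
  have hp := hw.isPerfect hspan (by omega)
  have : Nontrivial E := ⟨w 0, 0, hw.linearIndependent.ne_zero 0⟩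
  obtain ⟨c, hc, hid⟩ := exists_id_eq_smul_sum_unitVectors hp
    (isHalfIntegral_span (hw.inner_dRoot (by omega)))
  obtain ⟨i, j, hij, s, t, hs, ht, rfl⟩ := hw.mem_unitVectors_iff.1 hx
  obtain ⟨k, hk, l, hl, hkl⟩ := Finset.one_lt_card.1
    (show 1 < ({i, j}ᶜ : Finset (Fin (m + 2))).card by
      rw [Finset.card_compl, Finset.card_pair hij, Fintype.card_fin]; omega)
  simp only [Finset.mem_compl, Finset.mem_insert, Finset.mem_singleton, not_or] at hk hl
  have hs' : (s : ℝ) ^ 2 = 1 := by exact_mod_cast hs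
  have ht' : (t : ℝ) ^ 2 = 1 := by exact_mod_cast ht
  have hneg : (-t) ^ 2 = 1 := by rw [neg_sq, ht]
  have h1 : (1 : ℤ) ^ 2 = 1 := one_pow 2
  let f : Fin 4 → E := ![s • w i + t • w j, s • w i + (-t) • w j, (1 : ℤ) • w k + (1 : ℤ) • w l,
    (1 : ℤ) • w k + (-1 : ℤ) • w l]
  have hfΛ : ∀ r, f r ∈ unitVectors (dLattice w) := fun r => by
    rw [hw.mem_unitVectors_iff]
    fin_cases r
    · exact ⟨i, j, hij, s, t, hs, ht, rfl⟩
    · exact ⟨i, j, hij, s, -t, hs, hneg, rfl⟩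
    · exact ⟨k, l, hkl, 1, 1, by norm_num, by norm_num, rfl⟩
    · exact ⟨k, l, hkl, 1, -1, by norm_num, by norm_num, rfl⟩
  have hf : Orthonormal ℝ f := by
    refine ⟨fun r => (hfΛ r).2, fun p q hpq => ?_⟩
    fin_cases p <;> fin_cases q <;> first | exact absurd rfl hpq | skip
    all_goals
      simp [f, ← Int.cast_smul_eq_zsmul ℝ, inner_add_left, inner_add_right, real_inner_smul_left,
        real_inner_smul_right, hw _ _, hij, hij.symm, hk, hl, hkl, hkl.symm, Ne.symm hk.1,
        Ne.symm hk.2, Ne.symm hl.1, Ne.symm hl.2, -inner_self_eq_norm_sq_to_K]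
    all_goals linear_combination (hs' - ht') / 2
  have hhalf : (1 / 2 : ℝ) • (f 0 + f 1 + f 2 + f 3) ∈ dLattice w := by
    convert smul_add_smul_mem_dLattice w i k hs h1 using 1
    simp only [f, Matrix.cons_val, ← Int.cast_smul_eq_zsmul ℝ]
    push_cast
    module
  refine isSemiEutactic_of_id_mem (hp.1.diff_pair _) (id_mem_projCone_of_frame hp.1 hc hid hf hfΛ
    (halfFrame_mem hf (fun r => (hfΛ r).1) hhalf) fun y hy h2 h3 => ⟨hy, ?_⟩)
  rintro (h | h)
  · exact h2 h
  · exact h3 h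

-- The factor `⟪w 0, y⟫ * ⟪y, w 1⟫` is nonzero only for roots supported on the indices `0` and `1`,
-- and of these only `±(w 0 + w 1)` make it positive.
omit hspan in
theorem IsHalfFrame.inner_mul_inner_nonpos {y : E} (hy : y ∈ unitVectors (dLattice w))
    (hne : y ∉ ({w 0 + w 1, -(w 0 + w 1)} : Set E)) : ⟪w 0, y⟫ * ⟪y, w 1⟫ ≤ 0 := by
  obtain ⟨i, j, hij, s, t, hs, ht, rfl⟩ := hw.mem_unitVectors_iff.1 hy
  have hst : ∀ i j, (i = 0 ∧ j = 1 ∨ i = 1 ∧ j = 0) →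
      s • w i + t • w j ∉ ({w 0 + w 1, -(w 0 + w 1)} : Set E) → (s : ℝ) * t = -1 := by
    intro i j hij hne
    rcases sq_eq_one_iff.1 hs with rfl | rfl <;> rcases sq_eq_one_iff.1 ht with rfl | rfl
    · refine absurd (Or.inl ?_) hne
      rcases hij with ⟨rfl, rfl⟩ | ⟨rfl, rfl⟩ <;> simp [add_comm]
    · simp
    · simp
    · refine absurd (Or.inr ?_) hne
      rcases hij with ⟨rfl, rfl⟩ | ⟨rfl, rfl⟩ <;> simp [add_comm]
  simp only [← Int.cast_smul_eq_zsmul ℝ, inner_add_left, inner_add_right, real_inner_smul_left,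
    real_inner_smul_right, hw _ _]
  have key := hst i j
  by_cases h1 : i = 0 ∧ j = 1
  · obtain ⟨rfl, rfl⟩ := h1
    have := key (Or.inl ⟨rfl, rfl⟩) hne
    simp
    linarith
  by_cases h2 : i = 1 ∧ j = 0
  · obtain ⟨rfl, rfl⟩ := h2
    have := key (Or.inr ⟨rfl, rfl⟩) hne
    simp
    linarith
  rcases eq_or_ne i 0 with rfl | hi
  · have hj : j ≠ 1 := fun h => h1 ⟨rfl, h⟩
    simp [hj, hij]
  rcases eq_or_ne j 0 with rfl | hj
  · have hi' : i ≠ 1 := fun h => h2 ⟨h, rfl⟩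
    simp [hi']
  · simp [hi.symm, hj.symm]

-- A eutaxy relation paired with `w 0` and `w 1` would give zero on the left, but on the right a sum
-- of non-positive terms in which `w 0 - w 1` contributes a negative one.
omit hspan in
theorem IsHalfFrame.not_isEutactic_diff :
    ¬ IsEutactic (unitVectors (dLattice w) \ {w 0 + w 1, -(w 0 + w 1)}) := by
  rintro ⟨hT, v, ⟨-, hv⟩, hpos⟩
  have h01 : (0 : Fin (m + 2)) ≠ 1 := by simp
  have hmem : w 0 - w 1 ∈ unitVectors (dLattice w) \ {w 0 + w 1, -(w 0 + w 1)} := by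
    refine ⟨hw.mem_unitVectors_iff.2
      ⟨0, 1, h01, 1, -1, by simp, by simp, by simp [sub_eq_add_neg]⟩, ?_⟩
    rintro (h | h)
    · have := congrArg (fun y => ⟪y, w 1⟫) h
      simp only [inner_sub_left, inner_add_left, hw _ _, h01, if_true, if_false] at this
      norm_num at this
    · have := congrArg (fun y => ⟪y, w 0⟫) (Set.mem_singleton_iff.1 h)
      simp only [inner_sub_left, inner_neg_left, inner_add_left, hw _ _, h01.symm, if_true,
        if_false] at this
      norm_num at this
  rw [finsum_mem_smul_proj hT.finite] at hv
  have h := congrArg (fun Q : E →ₗ[ℝ] E => ⟪Q (w 0), w 1⟫) hv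
  simp only [LinearMap.id_apply, hw _ _, h01, if_false, LinearMap.sum_apply, LinearMap.smul_apply,
    proj_apply, sum_inner, real_inner_smul_left] at h
  refine absurd h (ne_of_gt (Finset.sum_neg' (fun y hy => ?_) ⟨w 0 - w 1, ?_, ?_⟩))
  · rw [Set.Finite.mem_toFinset] at hy
    refine mul_nonpos_of_nonneg_of_nonpos (hpos y hy).le ?_
    exact hw.inner_mul_inner_nonpos hy.1 hy.2
  · rw [Set.Finite.mem_toFinset]
    exact hmem
  · refine mul_neg_of_pos_of_neg (hpos _ hmem) ?_
    simp only [inner_sub_left, inner_sub_right, hw _ _, h01, if_true, if_false]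
    norm_num

end Config

theorem exists_isRootLattice_D {n : ℕ} (hn : 4 ≤ n) :
    ∃ Λ, IsRootLattice (CartanMatrix.D n) Λ := by
  obtain ⟨m, rfl⟩ : ∃ m, n = m + 2 := ⟨n - 2, by omega⟩
  obtain ⟨w, hw, -⟩ := exists_isHalfFrame (m + 2)
  exact ⟨_, dRoot w, hw.inner_dRoot (by omega), rfl⟩

/-- The Gram matrix determines the simple roots up to isometry, so the frame of a model lattice can
be carried over to `Λ`. -/
theorem exists_isHalfFrame_of_isRootLattice {m : ℕ} (hm : 1 ≤ m)
    {Λ : Submodule ℤ (EuclideanSpace ℝ (Fin (m + 2)))}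
    (hΛ : IsRootLattice (CartanMatrix.D (m + 2)) Λ) :
    ∃ w : Fin (m + 2) → EuclideanSpace ℝ (Fin (m + 2)), IsHalfFrame w ∧
      Submodule.span ℝ (Set.range w) = ⊤ ∧ Λ = dLattice w := by
  obtain ⟨a, ha, rfl⟩ := hΛ
  obtain ⟨w, hw, hspan⟩ := exists_isHalfFrame (m + 2)
  obtain ⟨b, hb⟩ := hw.exists_basis hspan
  have hgram : ∀ i j, ⟪a i, a j⟫ = ⟪b i, b j⟫ := fun i j => by
    rw [ha, hb, hw.inner_dRoot hm]
  obtain ⟨b', rfl⟩ := exists_basis_coe_eq (linearIndependent_of_gram b.linearIndependent hgram)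
  obtain ⟨g, hg⟩ := exists_linearIsometryEquiv b b' hgram
  refine ⟨g ∘ w, fun i j => by simp [hw _ _], ?_, ?_⟩
  · rw [Set.range_comp, ← LinearIsometryEquiv.coe_toLinearEquiv, ← LinearEquiv.coe_coe,
      ← Submodule.map_span, hspan, Submodule.map_top, LinearEquiv.range]
  · rw [dLattice]
    congr 2
    funext i
    rw [← hg, hb]
    induction i using Fin.lastCases with
    | last => simp [dRoot_last]
    | cast i => simp [dRoot_castSucc]

theorem isRedundantlySemiEutactic_D {n : ℕ} (hn : 4 ≤ n)
    {Λ : Submodule ℤ (EuclideanSpace ℝ (Fin n))} (hΛ : IsRootLattice (CartanMatrix.D n) Λ) :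
    IsRedundantlySemiEutactic (minimalConfiguration Λ) ∧
      ¬ IsRedundantlyExtreme (minimalConfiguration Λ) := by
  obtain ⟨m, rfl⟩ : ∃ m, n = m + 2 := ⟨n - 2, by omega⟩
  obtain ⟨w, hw, hspan, rfl⟩ := exists_isHalfFrame_of_isRootLattice (by omega) hΛ
  rw [dLattice, minimalConfiguration_span_eq (hw.inner_dRoot (by omega))
    (CartanMatrix.D_diag _), ← dLattice]
  refine ⟨⟨hw.isExtreme hspan (by omega), fun x hx => hw.isSemiEutactic_diff hspan (by omega) hx⟩,
    fun h => hw.not_isEutactic_diff (h.2 (w 0 + w 1) ?_).2⟩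
  exact hw.mem_unitVectors_iff.2 ⟨0, 1, by simp, 1, 1, by simp, by simp, by simp⟩

end TypeD

/-! ### The Golay code: weights and octads. -/

section Golay

/-- The binary vector of length `24` whose entries are the low binary digits of `N`. -/
def bitVector (N : ℕ) : Fin 24 → ZMod 2 := fun k => if N.testBit k then 1 else 0

theorem bitVector_zero : bitVector 0 = 0 := by
  funext k; simp [bitVector]

theorem bitVector_xor (M N : ℕ) : bitVector (M ^^^ N) = bitVector M + bitVector N := by
  funext k
  simp only [bitVector, Nat.testBit_xor, Pi.add_apply]
  cases M.testBit k <;> cases N.testBit k <;> decide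

/-- `N` is a sum of a subfamily of the list of binary words. -/
def IsSubsetSum : List ℕ → ℕ → Prop
  | [], N => N = 0
  | r :: rs, N => IsSubsetSum rs N ∨ IsSubsetSum rs (N ^^^ r)

instance IsSubsetSum.instDecidable : ∀ (l : List ℕ) (N : ℕ), Decidable (IsSubsetSum l N)
  | [], N => inferInstanceAs (Decidable (N = 0))
  | r :: rs, N =>
    have := IsSubsetSum.instDecidable rs
    inferInstanceAs (Decidable (IsSubsetSum rs N ∨ IsSubsetSum rs (N ^^^ r)))

/-- Whether `p` holds for all sums of `a` and a subfamily of the list of binary words. -/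
def allSubsetSums (p : ℕ → Bool) : List ℕ → ℕ → Bool
  | [], a => p a
  | r :: rs, a => allSubsetSums p rs a && allSubsetSums p rs (a ^^^ r)

theorem apply_of_allSubsetSums {p : ℕ → Bool} {l : List ℕ} {a N : ℕ}
    (h : allSubsetSums p l a) (hN : IsSubsetSum l N) : p (a ^^^ N) := by
  induction l generalizing a N with
  | nil =>
    rw [IsSubsetSum] at hN
    subst hN
    rwa [Nat.xor_zero]
  | cons r rs ih =>
    rw [allSubsetSums, Bool.and_eq_true] at h
    rcases hN with hN | hN
    · exact ih h.1 hN
    · have := ih h.2 hN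
      rwa [Nat.xor_comm N r, Nat.xor_assoc, ← Nat.xor_assoc r r, Nat.xor_self,
        Nat.zero_xor] at this

/-- Over `𝔽₂` the only coefficients are `0` and `1`, so a span is a set of subset sums, here
exclusive ors of binary words. -/
theorem mem_span_iff_isSubsetSum (l : List ℕ) (c : Fin 24 → ZMod 2) :
    c ∈ Submodule.span (ZMod 2) {v | ∃ r ∈ l, v = bitVector r} ↔
      ∃ N, IsSubsetSum l N ∧ c = bitVector N := by
  induction l generalizing c with
  | nil => simp [IsSubsetSum, bitVector_zero]
  | cons r rs ih =>
    have hset : {v | ∃ s ∈ r :: rs, v = bitVector s} =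
        insert (bitVector r) {v | ∃ s ∈ rs, v = bitVector s} := by
      ext v; simp
    have hxor : ∀ N, N ^^^ r ^^^ r = N := fun N => by
      rw [Nat.xor_assoc, Nat.xor_self, Nat.xor_zero]
    rw [hset, Submodule.mem_span_insert]
    constructor
    · rintro ⟨a, z, hz, rfl⟩
      obtain ⟨N, hN, rfl⟩ := (ih z).1 hz
      have ha : a = 0 ∨ a = 1 := by revert a; decide
      rcases ha with rfl | rfl
      · exact ⟨N, Or.inl hN, by simp⟩
      · refine ⟨N ^^^ r, Or.inr (by rwa [hxor]), ?_⟩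
        rw [bitVector_xor, one_smul, add_comm]
    · rintro ⟨N, hN | hN, rfl⟩
      · exact ⟨0, _, (ih _).2 ⟨N, hN, rfl⟩, by simp⟩
      · refine ⟨1, _, (ih _).2 ⟨_, hN, rfl⟩, ?_⟩
        rw [one_smul, add_comm, ← bitVector_xor, hxor]

/-- The word of the `k`-th cyclic shift of the generator of the Golay code, with parity bit. -/
def shiftWord (k : ℕ) : ℕ :=
  ([0, 2, 4, 5, 6, 10, 11].map fun d => 2 ^ ((d + k) % 23)).sum + 2 ^ 23

/-- The words of the generators of the Golay code. -/
def golayWords : List ℕ := (List.range 12).map shiftWord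

theorem mem_golayCode_iff (c : Fin 24 → ZMod 2) :
    c ∈ golayCode ↔ ∃ N, IsSubsetSum golayWords N ∧ c = bitVector N := by
  rw [← mem_span_iff_isSubsetSum, golayCode]
  have h : ∀ j : Fin 12, golayRow j = bitVector (shiftWord j) := by decide +kernel
  suffices Set.range golayRow = {v | ∃ r ∈ golayWords, v = bitVector r} by rw [this]
  ext v
  simp only [Set.mem_range, golayWords, List.mem_map, List.mem_range, Set.mem_ofPred_eq]
  constructor
  · rintro ⟨j, rfl⟩
    exact ⟨_, ⟨j, j.2, rfl⟩, h j⟩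
  · rintro ⟨_, ⟨j, hj, rfl⟩, rfl⟩
    exact ⟨⟨j, hj⟩, h ⟨j, hj⟩⟩

/-- The number of ones among the `n` lowest binary digits of `N`. -/
def bitCount (N : ℕ) : ℕ → ℕ
  | 0 => 0
  | n + 1 => bitCount N n + N / 2 ^ n % 2

theorem bitCount_eq_sum (N n : ℕ) : bitCount N n = ∑ k : Fin n, (N.testBit k).toNat := by
  induction n with
  | zero => simp [bitCount]
  | succ n ih => rw [bitCount, ih, Fin.sum_univ_castSucc]; simp [Nat.toNat_testBit]

theorem card_filter_bitVector (N : ℕ) :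
    (Finset.univ.filter fun k => bitVector N k ≠ 0).card = bitCount N 24 := by
  rw [bitCount_eq_sum, Finset.card_filter]
  refine Finset.sum_congr rfl fun k _ => ?_
  by_cases h : N.testBit k <;> simp [bitVector, h]

/-- Verified by running through all subset sums of the twelve generators: the code is doubly even
and has minimal weight eight. -/
theorem golay_weights {N : ℕ} (hN : IsSubsetSum golayWords N) :
    bitCount N 24 % 4 = 0 ∧ (N = 0 ∨ 8 ≤ bitCount N 24) := by
  have h : allSubsetSums
      (fun N => (bitCount N 24 % 4).beq 0 && (N.beq 0 || Nat.ble 8 (bitCount N 24)))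
      golayWords 0 := by
    decide +kernel
  have := apply_of_allSubsetSums h hN
  simpa only [Nat.zero_xor, Bool.and_eq_true, Bool.or_eq_true, Nat.beq_eq, Nat.ble_eq] using this

theorem four_dvd_weight {c : Fin 24 → ZMod 2} (hc : c ∈ golayCode) :
    4 ∣ (Finset.univ.filter fun k => c k ≠ 0).card := by
  obtain ⟨N, hN, rfl⟩ := (mem_golayCode_iff c).1 hc
  rw [card_filter_bitVector]
  exact Nat.dvd_of_mod_eq_zero (golay_weights hN).1

theorem eight_le_weight {c : Fin 24 → ZMod 2} (hc : c ∈ golayCode) (h0 : c ≠ 0) :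
    8 ≤ (Finset.univ.filter fun k => c k ≠ 0).card := by
  obtain ⟨N, hN, rfl⟩ := (mem_golayCode_iff c).1 hc
  rw [card_filter_bitVector]
  refine (golay_weights hN).2.resolve_left ?_
  rintro rfl
  exact h0 bitVector_zero

/-- All 23 cyclic shifts of the generator are octads of the code, also those that wrap around and
are not among the twelve rows. They already cover every pair of coordinates. -/
theorem shiftWord_mem : ∀ k : Fin 23, IsSubsetSum golayWords (shiftWord k) ∧
    bitCount (shiftWord k) 24 = 8 := by
  decide +kernel

theorem exists_shiftWord : ∀ i j : Fin 24, ∃ k : Fin 23,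
    (shiftWord k).testBit i ∧ (shiftWord k).testBit j := by
  decide +kernel

/-- Any two coordinates lie in a common octad of the Golay code. -/
theorem exists_octad {i j : Fin 24} (hij : i ≠ j) : ∃ o : Fin 8 → Fin 24,
    Function.Injective o ∧ o 0 = i ∧ o 1 = j ∧
      (∑ r, Pi.single (o r) 1 : Fin 24 → ZMod 2) ∈ golayCode := by
  obtain ⟨k, hi, hj⟩ := exists_shiftWord i j
  obtain ⟨hmem, hcard⟩ := shiftWord_mem k
  set N := shiftWord k
  set O : Finset (Fin 24) := Finset.univ.filter fun l => bitVector N l ≠ 0 with hO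
  have hmemO : ∀ l, l ∈ O ↔ N.testBit l := fun l => by
    by_cases h : N.testBit l <;> simp [hO, bitVector, h]
  have hOcard : O.card = 8 := by rw [hO, card_filter_bitVector, hcard]
  have hiO := (hmemO i).2 hi
  have hjO := (hmemO j).2 hj
  have h6 : ((O.erase i).erase j).card = 6 := by
    rw [Finset.card_erase_of_mem (Finset.mem_erase.2 ⟨hij.symm, hjO⟩),
      Finset.card_erase_of_mem hiO, hOcard]
  let e : Fin 6 ↪ Fin 24 := (((O.erase i).erase j).orderEmbOfFin h6).toEmbedding
  have he : ∀ r, e r ∈ (O.erase i).erase j := fun r => Finset.orderEmbOfFin_mem _ h6 r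
  simp only [Finset.mem_erase] at he
  let o : Fin 8 → Fin 24 := Fin.cons i (Fin.cons j e : Fin 7 → Fin 24)
  have ho : Function.Injective o := by
    refine Fin.cons_injective_iff.2 ⟨?_, Fin.cons_injective_iff.2 ⟨?_, e.injective⟩⟩
    · rintro ⟨r, hr⟩
      induction r using Fin.cases with
      | zero => exact hij hr.symm
      | succ r => exact (he r).2.1 hr
    · rintro ⟨r, hr⟩
      exact (he r).1 hr
  have hoO : ∀ r, o r ∈ O := fun r => by
    induction r using Fin.cases with
    | zero => exact hiO
    | succ r =>
      induction r using Fin.cases with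
      | zero => exact hjO
      | succ r => exact (he r).2.2
  refine ⟨o, ho, rfl, rfl, (mem_golayCode_iff _).2 ⟨N, hmem, ?_⟩⟩
  have himg : Finset.univ.image o = O := by
    refine Finset.eq_of_subset_of_card_le ?_ ?_
    · intro x hx
      obtain ⟨r, -, rfl⟩ := Finset.mem_image.1 hx
      exact hoO r
    · rw [Finset.card_image_of_injective _ ho, hOcard, Finset.card_univ, Fintype.card_fin]
  rw [← Finset.sum_image (f := fun l => (Pi.single l 1 : Fin 24 → ZMod 2)) ho.injOn, himg]
  funext l
  simp only [Finset.sum_apply, Pi.single_apply, Finset.sum_ite_eq, hmemO, bitVector]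

end Golay

/-! ### The Leech lattice and its sublattice `D₂₄`. -/

section Leech

/-- The vectors of `S` already span and carry positive weights, so `Id` is interior to the cone of
`S`, and the added vectors can be given small positive weights. -/
theorem IsExtreme.mono {E : Type*} [NormedAddCommGroup E] [InnerProductSpace ℝ E] {S T : Set E}
    (hS : IsExtreme S) (hT : IsConfiguration T) (hST : S ⊆ T) : IsExtreme T := by
  classical
  obtain ⟨hp, -, v, ⟨-, hv⟩, hpos⟩ := hS
  rw [finsum_mem_smul_proj hp.1.finite] at hv
  have hmem : ∀ x ∈ hp.1.finite.toFinset, v x • proj x ∈ projCone T := fun x hx => by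
    rw [Set.Finite.mem_toFinset] at hx
    exact smul_mem_projCone (proj_mem_projCone (hST hx)) (hpos x hx).le
  refine isExtreme_of_subset hT hST (fun Q hQ => (hp.2 Q).2 hQ) (hv ▸ sum_mem hmem)
    fun y hy => ⟨v y, hpos y hy, ?_⟩
  rw [hv, ← Finset.add_sum_erase _ _ (hp.1.finite.mem_toFinset.2 hy), add_sub_cancel_left]
  exact sum_mem fun x hx => hmem x (Finset.mem_of_mem_erase hx)

theorem two_rpow_neg_three_halves_sq : ((2 : ℝ) ^ (-(3 / 2) : ℝ)) ^ 2 = 1 / 8 := by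
  rw [← Real.rpow_natCast, ← Real.rpow_mul zero_le_two,
    show (-(3 / 2) : ℝ) * (2 : ℕ) = ((-3 : ℤ) : ℝ) by norm_num, Real.rpow_intCast]
  norm_num

theorem two_rpow_neg_three_halves : (2 : ℝ) ^ (-(3 / 2) : ℝ) = 2 * (2 : ℝ) ^ (-(5 / 2) : ℝ) := by
  rw [← Real.rpow_one_add' (by norm_num) (by norm_num)]; norm_num

/-- The vector `2^(-3/2) z`. -/
noncomputable def leechVec : (Fin 24 → ℤ) →ₗ[ℤ] EuclideanSpace ℝ (Fin 24) where
  toFun z := WithLp.toLp 2 fun i => (2 : ℝ) ^ (-(3 / 2) : ℝ) * (z i : ℝ)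
  map_add' z z' := by ext i; simp [mul_add]
  map_smul' r z := by ext i; simp; ring

theorem leechVec_apply (z : Fin 24 → ℤ) (i : Fin 24) :
    leechVec z i = (2 : ℝ) ^ (-(3 / 2) : ℝ) * (z i : ℝ) := rfl

theorem inner_leechVec (z z' : Fin 24 → ℤ) :
    ⟪leechVec z, leechVec z'⟫ = ((∑ i, z i * z' i : ℤ) : ℝ) / 8 := by
  rw [PiLp.inner_apply]
  push_cast
  rw [Finset.sum_div]
  refine Finset.sum_congr rfl fun i _ => ?_
  simp only [leechVec_apply, RCLike.inner_apply, conj_trivial]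
  linear_combination (z i : ℝ) * z' i * two_rpow_neg_three_halves_sq

theorem leechVec_mem {z : Fin 24 → ℤ} (h4 : 4 ∣ ∑ i, z i)
    (hz : (fun i => (z i : ZMod 2)) ∈ golayCode) : leechVec z ∈ leechLattice :=
  Or.inl ⟨z, h4, ⟨_, hz, fun _ => rfl⟩, rfl⟩

/-- Twice a vector of the Leech lattice has integral coordinates: it comes from an even vector `2z`,
or from an odd vector `2y + 1`. -/
theorem exists_of_mem_leechLattice {x : EuclideanSpace ℝ (Fin 24)} (hx : x ∈ leechLattice) :
    (∃ z : Fin 24 → ℤ, 4 ∣ ∑ i, z i ∧ (fun i => (z i : ZMod 2)) ∈ golayCode ∧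
      (2 : ℝ) • x = leechVec fun i => 2 * z i) ∨
    ∃ y : Fin 24 → ℤ, 4 ∣ ∑ i, y i + 2 ∧ (fun i => (y i : ZMod 2)) ∈ golayCode ∧
      (2 : ℝ) • x = leechVec fun i => 2 * y i + 1 := by
  rcases hx with ⟨z, h4, ⟨c, hc, hzc⟩, rfl⟩ | ⟨_, ⟨z, h4, ⟨c, hc, hzc⟩, rfl⟩, rfl⟩
  · refine Or.inl ⟨z, h4, by rwa [show (fun i => (z i : ZMod 2)) = c from funext hzc], ?_⟩
    ext i
    simp [leechVec_apply]
    ring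
  -- Twice the shifted vector has entries `2 z_i + 1`, except `2 z_0 - 3 = 2 (z_0 - 2) + 1`.
  -- Lowering `z_0` by `2` also turns the condition on the sum into `4 ∣ ∑ y_i + 2`.
  · refine Or.inr ⟨z - Pi.single 0 2, ?_, ?_, ?_⟩
    · simpa [Finset.sum_sub_distrib] using h4
    · convert hc using 1
      funext i
      rw [← hzc i]
      rcases eq_or_ne i 0 with rfl | hi
      · simp; decide
      · simp [hi]
    · ext i
      simp only [PiLp.smul_apply, PiLp.add_apply, leechShift, leechVec_apply, smul_eq_mul,
        two_rpow_neg_three_halves]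
      rcases eq_or_ne i 0 with rfl | hi
      · simp; ring
      · simp [hi]; ring

/-- A nonzero codeword forces at least eight odd coordinates. Otherwise `z = 2y` with `∑ y_i` even,
so `∑ y_i²` is even and positive. -/
theorem eight_le_sum_sq {z : Fin 24 → ℤ} (h4 : 4 ∣ ∑ i, z i)
    (hz : (fun i => (z i : ZMod 2)) ∈ golayCode) (h0 : z ≠ 0) : 8 ≤ ∑ i, z i ^ 2 := by
  by_cases hc : (fun i => (z i : ZMod 2)) = 0
  · have h2 : ∀ i, ∃ y, z i = 2 * y := fun i =>
      (ZMod.intCast_zmod_eq_zero_iff_dvd (z i) 2).1 (congrFun hc i)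
    choose y hy using h2
    have hsum : ∑ i, z i = 2 * ∑ i, y i := by simp only [hy, Finset.mul_sum]
    have hsq : ∑ i, z i ^ 2 = 4 * ∑ i, y i ^ 2 := by
      rw [Finset.mul_sum]
      exact Finset.sum_congr rfl fun i _ => by rw [hy]; ring
    have heven : 2 ∣ ∑ i, y i := by omega
    have hpar : 2 ∣ ∑ i, y i ^ 2 := by
      have : (2 : ℤ) ∣ ∑ i, (y i ^ 2 - y i) := Finset.dvd_sum fun i _ => by
        have := Int.even_mul_succ_self (y i - 1)
        rw [show y i ^ 2 - y i = (y i - 1) * (y i - 1 + 1) by ring]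
        exact this.two_dvd
      rw [Finset.sum_sub_distrib] at this
      omega
    have hpos : 0 < ∑ i, y i ^ 2 := by
      obtain ⟨i, hi⟩ : ∃ i, z i ≠ 0 := by
        by_contra! hall
        exact h0 (funext hall)
      refine Finset.sum_pos' (fun _ _ => sq_nonneg _) ⟨i, Finset.mem_univ i, ?_⟩
      have : y i ≠ 0 := fun h => hi (by rw [hy, h, mul_zero])
      positivity
    omega
  · have h8 := eight_le_weight hz hc
    have hle : ((Finset.univ.filter fun k => ((z k : ℤ) : ZMod 2) ≠ 0).card : ℤ) ≤
        ∑ i, z i ^ 2 := by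
      rw [Finset.card_filter]
      push_cast
      refine Finset.sum_le_sum fun i _ => ?_
      split_ifs with h
      · have : z i ≠ 0 := fun h' => h (by simp [h'])
        have : 0 < z i ^ 2 := by positivity
        omega
      · positivity
    have : (8 : ℤ) ≤ ((Finset.univ.filter fun k => ((z k : ℤ) : ZMod 2) ≠ 0).card : ℤ) := by
      exact_mod_cast h8
    exact this.trans hle

/-- The sum is `24 + 4 ∑ y_i (y_i + 1)`, where the last sum is even and non-negative. If it
vanished, every `y_i` would be `0` or `-1` and `-∑ y_i` the weight of a codeword, divisible by four,
against `4 ∣ ∑ y_i + 2`. -/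
theorem thirtytwo_le_sum_sq {y : Fin 24 → ℤ} (h4 : 4 ∣ ∑ i, y i + 2)
    (hy : (fun i => (y i : ZMod 2)) ∈ golayCode) : 32 ≤ ∑ i, (2 * y i + 1) ^ 2 := by
  have hsq : ∑ i, (2 * y i + 1) ^ 2 = 24 + 4 * ∑ i, y i * (y i + 1) := by
    rw [Finset.mul_sum, show (24 : ℤ) = ∑ _i : Fin 24, 1 by simp, ← Finset.sum_add_distrib]
    exact Finset.sum_congr rfl fun i _ => by ring
  have hnn : ∀ i, 0 ≤ y i * (y i + 1) := fun i => by
    rcases le_or_gt 0 (y i) with h | h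
    · positivity
    · exact mul_nonneg_of_nonpos_of_nonpos h.le (by omega)
  have hpar : 2 ∣ ∑ i, y i * (y i + 1) := Finset.dvd_sum fun i _ =>
    (Int.even_mul_succ_self (y i)).two_dvd
  have hnn' : 0 ≤ ∑ i, y i * (y i + 1) := Finset.sum_nonneg fun i _ => hnn i
  have hne : ∑ i, y i * (y i + 1) ≠ 0 := fun h0 => by
    have hval : ∀ i, y i = -(if ((y i : ℤ) : ZMod 2) ≠ 0 then 1 else 0) := fun i => by
      have := (Finset.sum_eq_zero_iff_of_nonneg fun i _ => hnn i).1 h0 i (Finset.mem_univ i)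
      rcases mul_eq_zero.1 this with h | h
      · simp [h]
      · rw [eq_neg_of_add_eq_zero_left h]
        simp
    have hw := four_dvd_weight hy
    have hw' : (4 : ℤ) ∣ ((Finset.univ.filter fun k => ((y k : ℤ) : ZMod 2) ≠ 0).card : ℤ) := by
      exact_mod_cast hw
    rw [Finset.card_filter] at hw'
    push_cast at hw'
    have hsum : ∑ i, y i = -∑ i, (if ((y i : ℤ) : ZMod 2) ≠ 0 then 1 else 0) := by
      rw [← Finset.sum_neg_distrib]
      exact Finset.sum_congr rfl fun i _ => hval i
    omega
  omega

theorem one_le_inner_self_of_mem_leechLattice {x : EuclideanSpace ℝ (Fin 24)}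
    (hx : x ∈ leechLattice) (hx0 : x ≠ 0) : 1 ≤ ⟪x, x⟫ := by
  have h4 : ⟪(2 : ℝ) • x, (2 : ℝ) • x⟫ = 4 * ⟪x, x⟫ := by
    rw [real_inner_smul_left, real_inner_smul_right]; ring
  rcases exists_of_mem_leechLattice hx with ⟨z, hz4, hz, hxz⟩ | ⟨y, hy4, hy, hxy⟩
  · have hz0 : z ≠ 0 := by
      rintro rfl
      have : (2 : ℝ) • x = 0 := by rw [hxz]; ext i; simp [leechVec_apply]
      exact hx0 ((smul_eq_zero.1 this).resolve_left two_ne_zero)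
    have h := eight_le_sum_sq hz4 hz hz0
    rw [hxz, inner_leechVec, show ∑ i, 2 * z i * (2 * z i) = 4 * ∑ i, z i ^ 2 by
      rw [Finset.mul_sum]; exact Finset.sum_congr rfl fun i _ => by ring] at h4
    have h' : (8 : ℝ) ≤ ((∑ i, z i ^ 2 : ℤ) : ℝ) := by exact_mod_cast h
    push_cast at h4 h'
    linarith
  · have h := thirtytwo_le_sum_sq hy4 hy
    rw [hxy, inner_leechVec, show ∑ i, (2 * y i + 1) * (2 * y i + 1) = ∑ i, (2 * y i + 1) ^ 2 from
      Finset.sum_congr rfl fun i _ => by ring] at h4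
    have h' : (32 : ℝ) ≤ ((∑ i, (2 * y i + 1) ^ 2 : ℤ) : ℝ) := by exact_mod_cast h
    linarith

theorem finite_unitVectors_leechLattice : (unitVectors leechLattice).Finite := by
  have hfin : (Set.pi Set.univ fun _ : Fin 24 => Set.Icc (-6 : ℤ) 6).Finite :=
    Set.Finite.pi fun _ => Set.finite_Icc _ _
  refine (hfin.image fun k => (1 / 2 : ℝ) • leechVec k).subset fun x hx => ?_
  obtain ⟨k, hk⟩ : ∃ k, (2 : ℝ) • x = leechVec k := by
    rcases exists_of_mem_leechLattice hx.1 with ⟨z, -, -, h⟩ | ⟨y, -, -, h⟩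
    exacts [⟨_, h⟩, ⟨_, h⟩]
  have h4 : ⟪(2 : ℝ) • x, (2 : ℝ) • x⟫ = 4 * ⟪x, x⟫ := by
    rw [real_inner_smul_left, real_inner_smul_right]; ring
  rw [hk, inner_leechVec, inner_self_of_mem_unitVectors hx] at h4
  have hsum : ∑ i, k i * k i = 32 := by
    have : ((∑ i, k i * k i : ℤ) : ℝ) = 32 := by linarith
    exact_mod_cast this
  refine ⟨k, fun i _ => ?_, ?_⟩
  · have : k i * k i ≤ 32 := hsum ▸ Finset.single_le_sum (f := fun i => k i * k i)
      (fun j _ => mul_self_nonneg (k j)) (Finset.mem_univ i)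
    constructor <;> nlinarith
  · simp only [← hk]
    module

/-- The orthogonal frame of vectors `2^(-1/2) eᵢ`. -/
noncomputable def leechFrame (i : Fin 24) : EuclideanSpace ℝ (Fin 24) :=
  (2 : ℤ) • leechVec (Pi.single i 1)

theorem isHalfFrame_leechFrame : IsHalfFrame leechFrame := fun i j => by
  rw [leechFrame, leechFrame, ← map_smul, ← map_smul, inner_leechVec]
  rcases eq_or_ne i j with rfl | hij
  · rw [Finset.sum_eq_single i (fun k _ hk => by simp [hk]) (by simp)]
    norm_num
  · rw [Finset.sum_eq_zero fun k _ => ?_]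
    · simp [hij]
    · rcases eq_or_ne k i with rfl | hk
      · simp [hij]
      · simp [hk]

theorem span_leechFrame : Submodule.span ℝ (Set.range leechFrame) = ⊤ := by
  obtain ⟨b, hb⟩ := exists_basis_coe_eq isHalfFrame_leechFrame.linearIndependent
  exact hb ▸ b.span_eq

theorem dLattice_le_leechLattice : dLattice (m := 22) leechFrame ≤ leechLattice := by
  have hmod : ∀ i j : Fin 24, ∀ s t : ℤ, 4 ∣ 2 * s + 2 * t →
      s • leechFrame i + t • leechFrame j ∈ leechLattice := fun i j s t h => by
    rw [leechFrame, leechFrame, smul_smul, smul_smul, ← map_smul, ← map_smul, ← map_add]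
    refine leechVec_mem ?_ ?_
    · simp [Finset.sum_add_distrib, ← Finset.mul_sum]
      rwa [mul_comm s, mul_comm t]
    · convert golayCode.zero_mem using 1
      funext k
      have h2 : (2 : ZMod 2) = 0 := rfl
      simp [h2]
  refine Submodule.span_le.2 ?_
  rintro _ ⟨i, rfl⟩
  induction i using Fin.lastCases with
  | last => rw [dRoot_last]; simpa using hmod _ _ 1 1 (by norm_num)
  | cast i => rw [dRoot_castSucc]; simpa [sub_eq_add_neg] using hmod _ _ 1 (-1) (by norm_num)

/-- Four orthogonal roots of type `D` supported on an octad, whose signs have product one. -/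
noncomputable def octadFrame (o : Fin 8 → Fin 24) (s t : ℤ) : Fin 4 → EuclideanSpace ℝ (Fin 24) :=
  ![s • leechFrame (o 0) + t • leechFrame (o 1),
    (1 : ℤ) • leechFrame (o 2) + (s * t) • leechFrame (o 3),
    (1 : ℤ) • leechFrame (o 4) + (1 : ℤ) • leechFrame (o 5),
    (1 : ℤ) • leechFrame (o 6) + (1 : ℤ) • leechFrame (o 7)]

section Octad

variable {o : Fin 8 → Fin 24} (ho : Function.Injective o) {s t : ℤ} (hs : s ^ 2 = 1)
  (ht : t ^ 2 = 1)

include ho hs ht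

theorem octadFrame_mem (r : Fin 4) :
    octadFrame o s t r ∈ unitVectors (dLattice (m := 22) leechFrame) := by
  rw [isHalfFrame_leechFrame.mem_unitVectors_iff]
  have hst : (s * t) ^ 2 = 1 := by rw [mul_pow, hs, ht, mul_one]
  have hne : ∀ p q : Fin 8, p ≠ q → o p ≠ o q := fun p q h => ho.ne h
  fin_cases r
  · exact ⟨_, _, hne 0 1 (by decide), s, t, hs, ht, rfl⟩
  · exact ⟨_, _, hne 2 3 (by decide), 1, s * t, one_pow 2, hst, rfl⟩
  · exact ⟨_, _, hne 4 5 (by decide), 1, 1, one_pow 2, one_pow 2, rfl⟩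
  · exact ⟨_, _, hne 6 7 (by decide), 1, 1, one_pow 2, one_pow 2, rfl⟩

theorem orthonormal_octadFrame : Orthonormal ℝ (octadFrame o s t) := by
  refine ⟨fun r => (octadFrame_mem ho hs ht r).2, fun p q hpq => ?_⟩
  fin_cases p <;> fin_cases q <;> first | exact absurd rfl hpq | skip
  all_goals
    simp [octadFrame, ← Int.cast_smul_eq_zsmul ℝ, inner_add_left, inner_add_right,
      real_inner_smul_left, real_inner_smul_right, isHalfFrame_leechFrame _ _, ho.eq_iff]

omit ho in
theorem half_sum_octadFrame_mem
    (hcode : (∑ r, Pi.single (o r) 1 : Fin 24 → ZMod 2) ∈ golayCode) :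
    (1 / 2 : ℝ) • (octadFrame o s t 0 + octadFrame o s t 1 + octadFrame o s t 2 +
      octadFrame o s t 3) ∈ leechLattice := by
  let σ : Fin 8 → ℤ := ![s, t, 1, s * t, 1, 1, 1, 1]
  have h : (1 / 2 : ℝ) • (octadFrame o s t 0 + octadFrame o s t 1 + octadFrame o s t 2 +
      octadFrame o s t 3) = leechVec (∑ r, σ r • Pi.single (o r) 1) := by
    rw [map_sum, Fin.sum_univ_eight]
    simp only [map_smul, octadFrame, leechFrame, σ, Matrix.cons_val, ← Int.cast_smul_eq_zsmul ℝ]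
    push_cast
    module
  rw [h]
  refine leechVec_mem ?_ ?_
  -- The signs sum to `(1 + s)(1 + t) + 4`, a multiple of four; the sign `s * t` in the frame is
  -- chosen for this.
  · simp only [Finset.sum_apply, Pi.smul_apply, smul_eq_mul]
    rw [Finset.sum_comm]
    simp only [← Finset.mul_sum, Finset.sum_pi_single', Finset.mem_univ, if_true, mul_one,
      Fin.sum_univ_eight, σ, Matrix.cons_val]
    rcases sq_eq_one_iff.1 hs with rfl | rfl <;> rcases sq_eq_one_iff.1 ht with rfl | rfl <;>
      norm_num
  · convert hcode using 1
    have hσ : ∀ r, ((σ r : ℤ) : ZMod 2) = 1 := by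
      intro r
      have h1 : (-1 : ZMod 2) = 1 := rfl
      rcases sq_eq_one_iff.1 hs with rfl | rfl <;> rcases sq_eq_one_iff.1 ht with rfl | rfl <;>
        fin_cases r <;> simp [σ, h1]
    funext k
    simp only [Finset.sum_apply, Pi.smul_apply, smul_eq_mul]
    push_cast
    refine Finset.sum_congr rfl fun r _ => ?_
    rw [hσ, one_mul]
    rcases eq_or_ne k (o r) with rfl | hk
    · simp
    · simp [hk]

theorem hasFramePair_octad (hcode : (∑ r, Pi.single (o r) 1 : Fin 24 → ZMod 2) ∈ golayCode) :
    HasFramePair (dLattice (m := 22) leechFrame) leechLattice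
      (s • leechFrame (o 0) + t • leechFrame (o 1)) := by
  -- The octad is paired anew as `01|24|36|57` instead of `01|23|45|67`. Only `01` is shared, so the
  -- other members of the two frames have inner products `0` or `±1/2`.
  let τ : Fin 8 → Fin 8 := ![0, 1, 2, 4, 3, 6, 5, 7]
  have hτ : Function.Bijective τ := by decide
  have hoτ : Function.Injective (o ∘ τ) := ho.comp hτ.injective
  have hcode' : (∑ r, Pi.single ((o ∘ τ) r) 1 : Fin 24 → ZMod 2) ∈ golayCode := by
    rw [← hτ.sum_comp (fun r => (Pi.single (o r) 1 : Fin 24 → ZMod 2))] at hcode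
    exact hcode
  have hinner : ∀ i j, i ≠ 0 → j ≠ 0 →
      ⟪octadFrame o s t i, octadFrame (o ∘ τ) s t j⟫ ^ 2 ≠ 1 := by
    intro i j hi hj
    rcases sq_eq_one_iff.1 hs with rfl | rfl <;> rcases sq_eq_one_iff.1 ht with rfl | rfl <;>
      fin_cases i <;> fin_cases j <;> first | exact absurd rfl hi | exact absurd rfl hj | skip
    all_goals
      simp [octadFrame, τ, ← Int.cast_smul_eq_zsmul ℝ, inner_add_left, inner_add_right,
        isHalfFrame_leechFrame _ _, ho.eq_iff, -inner_self_eq_norm_sq_to_K]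
    all_goals norm_num
  refine ⟨octadFrame o s t, octadFrame (o ∘ τ) s t, orthonormal_octadFrame ho hs ht,
    orthonormal_octadFrame hoτ hs ht, rfl, rfl, fun r => (octadFrame_mem ho hs ht r).1,
    fun r => (octadFrame_mem hoτ hs ht r).1, half_sum_octadFrame_mem hs ht hcode,
    half_sum_octadFrame_mem hs ht hcode', fun i j hi hj => ?_⟩
  have h1 := inner_self_of_mem_unitVectors (octadFrame_mem hoτ hs ht j)
  constructor <;> intro h <;> refine hinner i j hi hj ?_ <;> rw [h]
  · rw [h1, one_pow]
  · rw [inner_neg_left, h1]; norm_num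

end Octad

theorem isRedundantlyExtreme_leechLattice :
    IsRedundantlyExtreme (minimalConfiguration leechLattice) := by
  have hw := isHalfFrame_leechFrame
  have hle := dLattice_le_leechLattice
  have hsub : unitVectors (dLattice (m := 22) leechFrame) ⊆ unitVectors leechLattice :=
    fun x hx => ⟨hle hx.1, hx.2⟩
  have hconf := isConfiguration_unitVectors finite_unitVectors_leechLattice
  have hD : IsExtreme (unitVectors (dLattice (m := 22) leechFrame)) :=
    hw.isExtreme span_leechFrame (by norm_num)
  rw [minimalConfiguration_eq_unitVectors ?_ fun x => one_le_inner_self_of_mem_leechLattice]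
  · refine ⟨hD.mono hconf hsub, fun x hx => ?_⟩
    by_cases hxD : x ∈ unitVectors (dLattice (m := 22) leechFrame)
    · obtain ⟨i, j, hij, s, t, hs, ht, rfl⟩ := hw.mem_unitVectors_iff.1 hxD
      obtain ⟨o, ho, rfl, rfl, hcode⟩ := exists_octad hij
      exact (hasFramePair_octad ho hs ht hcode).isExtreme_diff hle hD.1
        (isHalfIntegral_span (hw.inner_dRoot (by norm_num))) finite_unitVectors_leechLattice
    -- If `x` is not a root of `D₂₄`, neither is `-x`, and the extreme configuration of `D₂₄`
    -- survives intact.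
    · refine hD.mono (hconf.diff_pair x) fun y hy => ⟨hsub hy, ?_⟩
      rintro (rfl | h)
      · exact hxD hy
      · refine hxD ?_
        rw [← neg_neg x, ← Set.mem_singleton_iff.1 h]
        exact hD.1.1.neg_mem y hy
  · obtain ⟨o, ho, -⟩ := exists_octad (i := 0) (j := 1) (by decide)
    have := hsub (octadFrame_mem (s := 1) (t := 1) ho (by norm_num) (by norm_num) 0)
    exact ⟨_, this⟩

end Leech

end PerfectEutactic

theorem mainTheorem8 :
    (∀ n : ℕ, 2 ≤ n →
      (∃ Λ, IsRootLattice (CartanMatrix.A n) Λ) ∧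
      ∀ Λ, IsRootLattice (CartanMatrix.A n) Λ → IsMinimallyExtreme (minimalConfiguration Λ)) ∧
    (∀ n : ℕ, 4 ≤ n →
      (∃ Λ, IsRootLattice (CartanMatrix.D n) Λ) ∧
      ∀ Λ, IsRootLattice (CartanMatrix.D n) Λ →
        IsRedundantlySemiEutactic (minimalConfiguration Λ) ∧
        ¬ IsRedundantlyExtreme (minimalConfiguration Λ)) ∧
    ((∃ Λ, IsRootLattice CartanMatrix.E₆ Λ) ∧
      ∀ Λ, IsRootLattice CartanMatrix.E₆ Λ → IsRedundantlyExtreme (minimalConfiguration Λ)) ∧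
    ((∃ Λ, IsRootLattice CartanMatrix.E₇ Λ) ∧
      ∀ Λ, IsRootLattice CartanMatrix.E₇ Λ → IsRedundantlyExtreme (minimalConfiguration Λ)) ∧
    ((∃ Λ, IsRootLattice CartanMatrix.E₈ Λ) ∧
      ∀ Λ, IsRootLattice CartanMatrix.E₈ Λ → IsRedundantlyExtreme (minimalConfiguration Λ)) ∧
    IsRedundantlyExtreme (minimalConfiguration leechLattice) := by
  exact ⟨fun n hn => ⟨exists_isRootLattice_A n, fun _ hΛ => isMinimallyExtreme_A (by omega) hΛ⟩,
    fun n hn => ⟨exists_isRootLattice_D hn, fun _ hΛ => isRedundantlySemiEutactic_D hn hΛ⟩,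
    ⟨exists_isRootLattice_E₆, fun _ => isRedundantlyExtreme_E₆⟩,
    ⟨exists_isRootLattice_E₇, fun _ => isRedundantlyExtreme_E₇⟩,
    ⟨exists_isRootLattice_E₈, fun _ => isRedundantlyExtreme_E₈⟩,
    isRedundantlyExtreme_leechLattice⟩
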